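/- We work in classical many-sorted first-order logic with equality. All domains of structures are non-empty, each sort has its own countably infinite set of variables, and an interpretation is a structure together with a value for every variable. A theory $\mathcal{T}$ is the class of all structures (its models) satisfying a set $Ax(\mathcal{T})$ of closed formulas; a $\mathcal{T}$-interpretation is an interpretation whose underlying structure is a model of $\mathcal{T}$. A formula is $\mathcal{T}$-satisfiable (respectively $\mathcal{T}$-valid, written $\vdash_{\mathcal{T}}$) if some (respectively every) $\mathcal{T}$-interpretation satisfies it, and two formulas are $\mathcal{T}$-equivalent if every $\mathcal{T}$-interpretation satisfies one iff it satisfies the other. For a formula $\phi$, $\mathit{vars}(\phi)$ is the set of its free variables, $\mathit{vars}_\sigma(\phi)$ the set of those of sort $\sigma$, and for a set $X$ of variables $X^{\mathcal{A}}=\{x^{\mathcal{A}} : x\in X\}$. Let $S$ be the set of all sorts of the signature. The theory $\mathcal{T}$ is, with respect to $S$: - stably infinite if every $\mathcal{T}$-satisfiable quantifier-free formula is satisfied by a $\mathcal{T}$-interpretation $\mathcal{A}$ with $\sigma^{\mathcal{A}}$ infinite for all $\sigma\in S$; - smooth if for every quantifier-free $\phi$, every $\mathcal{T}$-interpretation $\mathcal{A}$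 satisfying $\phi$ and every function $\kappa$ from $S$ to the cardinals with $\kappa(\sigma)\ge|\sigma^{\mathcal{A}}|$ for all $\sigma\in S$, there is a $\mathcal{T}$-interpretation $\mathcal{B}$ satisfying $\phi$ with $|\sigma^{\mathcal{B}}|=\kappa(\sigma)$ for all $\sigma\in S$; - finitely witnessable if there is a computable function $\mathit{wit}$ from quantifier-free formulas to quantifier-free formulas such that for every quantifier-free $\phi$: (i) $\phi$ and $\exists \overrightarrow{w}.\,\mathit{wit}(\phi)$ are $\mathcal{T}$-equivalent, where $\overrightarrow{w}=\mathit{vars}(\mathit{wit}(\phi))\setminus\mathit{vars}(\phi)$; and (ii) if $\mathit{wit}(\phi)$ is $\mathcal{T}$-satisfiable, then some $\mathcal{T}$-interpretation $\mathcal{A}$ satisfies $\mathit{wit}(\phi)$ with $\sigma^{\mathcal{A}}=\mathit{vars}_\sigma(\mathit{wit}(\phi))^{\mathcal{A}}$ for all $\sigma\in S$; - strongly finitely witnessable if there is a computable $\mathit{wit}$ satisfying (i) and, instead of (ii): (ii') for every finite set $V$ of variables and every arrangement $\delta_V$ on $V$ (that is, given an equivalence relation on the variables of each sort in $V$, the conjunction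 of $x=y$ for related and $\neg(x=y)$ for unrelated $x,y\in V$ of the same sort), if $\mathit{wit}(\phi)\wedge\delta_V$ is $\mathcal{T}$-satisfiable, then some $\mathcal{T}$-interpretation $\mathcal{A}$ satisfies $\mathit{wit}(\phi)\wedge\delta_V$ with $\sigma^{\mathcal{A}}=\mathit{vars}_\sigma(\mathit{wit}(\phi)\wedge\delta_V)^{\mathcal{A}}$ for all $\sigma\in S$; - convex if for every conjunction of literals $\phi$, every $m\ge 1$ and all pairs of variables $(u_1,v_1),\dots,(u_m,v_m)$, each pair being of one sort in $S$, $\vdash_{\mathcal{T}}\phi\rightarrow\bigvee_{i=1}^m u_i=v_i$ implies $\vdash_{\mathcal{T}}\phi\rightarrow u_i=v_i$ for some $i$. Let $n\ge 1$, let $\Sigma_n$ be the empty signature (no symbols other than equality) with sorts $S=\{\sigma_1,\dots,\sigma_n\}$, and let $\Sigma^n_s$ be the signature with the same sorts and a single function symbol $s$, of arity $\sigma_1\to\sigma_1$. For a $\Sigma_n$-theory $\mathcal{T}$, let $\mathcal{T}_\vee$ be the $\Sigma^n_s$-theory axiomatized by $Ax(\mathcal{T})\cup\{\psi_\vee\}$,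 where $$\psi_\vee=\forall x.\,\big[\,s(s(x))=x\ \vee\ s(s(x))=s(x)\,\big]$$ and $x$ is a variable of sort $\sigma_1$. **Lemma.** Let $\mathcal{T}$ be a $\Sigma_n$-theory. Then $\mathcal{T}_\vee$ is stably infinite, smooth, finitely witnessable, or strongly finitely witnessable with respect to $S$ if and only if $\mathcal{T}$ is, respectively, stably infinite, smooth, finitely witnessable, or strongly finitely witnessable with respect to $S$. In addition, if $\mathcal{T}$ has a model $\mathcal{A}$ with $|\sigma_1^{\mathcal{A}}|\ge 2$, then $\mathcal{T}_\vee$ is not convex with respect to $S$. -/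

import Mathlib

/-! Many-sorted first-order logic with equality, the model-theoretic properties used in theory
combination, and the construction that adds a unary function symbol subject to
`∀ x, s (s x) = x ∨ s (s x) = s x`. -/

namespace ManySorted

/-- A many-sorted signature: countable (encoded) sets of sorts, function symbols and predicate
symbols with their arities. The equality symbols are built into formulas. -/
structure Sig where
  Srt : Type
  Fn : Type
  Pr : Type
  [encSrt : Encodable Srt]
  [encFn : Encodable Fn]
  [encPr : Encodable Pr]
  fnAr : Fn → ℕ
  fnDom : (f : Fn) → Fin (fnAr f) → Srt
  fnCod : Fn → Srt
  prAr : Pr → ℕ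
  prDom : (P : Pr) → Fin (prAr P) → Srt

attribute [instance] Sig.encSrt Sig.encFn Sig.encPr

/-- Variables: a distinct countably infinite supply for each sort; `(σ, i)` is the `i`-th variable
of sort `σ`. -/
abbrev Sig.Var (L : Sig) : Type := L.Srt × ℕ

instance Sig.decSrt (L : Sig) : DecidableEq L.Srt := Encodable.decidableEqOfEncodable L.Srt

/-- Terms of each sort. -/
inductive Term (L : Sig) : L.Srt → Type
  | var (σ : L.Srt) (i : ℕ) : Term L σ
  | app (f : L.Fn) (args : (k : Fin (L.fnAr f)) → Term L (L.fnDom f k)) : Term L (L.fnCod f)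

/-- Formulas. The primitive connectives are `⊥`, `→` and `∀`; the others are defined below. -/
inductive Fml (L : Sig) : Type
  | falsum : Fml L
  | eq {σ : L.Srt} (t u : Term L σ) : Fml L
  | rel (P : L.Pr) (args : (k : Fin (L.prAr P)) → Term L (L.prDom P k)) : Fml L
  | imp (φ ψ : Fml L) : Fml L
  | all (x : L.Var) (φ : Fml L) : Fml L

/-- The variables of a term. -/
def Term.vars {L : Sig} : {σ : L.Srt} → Term L σ → Finset L.Var
  | _, .var σ i => {(σ, i)}
  | _, .app _ args => Finset.univ.biUnion fun k => (args k).vars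

namespace Fml

variable {L : Sig}

def neg (φ : Fml L) : Fml L := φ.imp falsum

def verum : Fml L := neg falsum

def or (φ ψ : Fml L) : Fml L := φ.neg.imp ψ

def and (φ ψ : Fml L) : Fml L := (φ.imp ψ.neg).neg

def ex (x : L.Var) (φ : Fml L) : Fml L := (all x φ.neg).neg

/-- Finite conjunction; the empty one is `⊤`. -/
def bigAnd : List (Fml L) → Fml L
  | [] => verum
  | φ :: l => φ.and (bigAnd l)

/-- Finite disjunction; the empty one is `⊥`. -/
def bigOr : List (Fml L) → Fml L
  | [] => falsum
  | φ :: l => φ.or (bigOr l)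

/-- `∃ x₁ … xₘ, φ`. -/
def exs : List L.Var → Fml L → Fml L
  | [], φ => φ
  | x :: l, φ => ex x (exs l φ)

/-- The free variables of a formula. -/
def vars : Fml L → Finset L.Var
  | falsum => ∅
  | eq t u => t.vars ∪ u.vars
  | rel _ args => Finset.univ.biUnion fun k => (args k).vars
  | imp φ ψ => φ.vars ∪ ψ.vars
  | all x φ => φ.vars.erase x

/-- Quantifier-free formulas. -/
def IsQF : Fml L → Prop
  | falsum => True
  | eq _ _ => True
  | rel _ _ => True
  | imp φ ψ => φ.IsQF ∧ ψ.IsQF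
  | all _ _ => False

inductive IsAtomic : Fml L → Prop
  | eq {σ : L.Srt} (t u : Term L σ) : IsAtomic (Fml.eq t u)
  | rel (P : L.Pr) (args : (k : Fin (L.prAr P)) → Term L (L.prDom P k)) : IsAtomic (Fml.rel P args)

def IsLiteral (φ : Fml L) : Prop := φ.IsAtomic ∨ ∃ ψ : Fml L, ψ.IsAtomic ∧ φ = ψ.neg

/-- The equation `xᵢ = xⱼ` between two variables of sort `σ`. -/
def eqVar (σ : L.Srt) (i j : ℕ) : Fml L := Fml.eq (Term.var σ i) (Term.var σ j)

open Classical in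
/-- The arrangement on the finite set of variables `V` induced by equivalence relations on the
variables of each sort: the conjunction over all pairs of variables in `V` of the same sort, of
`x = y` if `x` and `y` are related and of `¬ (x = y)` otherwise. -/
noncomputable def arrangement (V : Finset L.Var) (E : L.Srt → Setoid ℕ) : Fml L :=
  bigAnd (((V ×ˢ V).filter fun p => p.1.1 = p.2.1).toList.map fun p =>
    if E p.1.1 p.1.2 p.2.2 then eqVar p.1.1 p.1.2 p.2.2 else (eqVar p.1.1 p.1.2 p.2.2).neg)

end Fml

/-- Quantifier-free formulas, as a type. -/
abbrev QF (L : Sig) : Type := {φ : Fml L // φ.IsQF}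

/-- Gödel numbering of terms. -/
def Term.code {L : Sig} : {σ : L.Srt} → Term L σ → ℕ
  | _, .var σ i => Nat.pair 0 (Nat.pair (Encodable.encode σ) i)
  | _, .app f args =>
      Nat.pair 1 (Nat.pair (Encodable.encode f) (Encodable.encode (List.ofFn fun k => (args k).code)))

/-- Gödel numbering of formulas. -/
def Fml.code {L : Sig} : Fml L → ℕ
  | .falsum => Nat.pair 0 0
  | .eq t u => Nat.pair 1 (Nat.pair t.code u.code)
  | .rel P args =>
      Nat.pair 2 (Nat.pair (Encodable.encode P) (Encodable.encode (List.ofFn fun k => (args k).code)))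
  | .imp φ ψ => Nat.pair 3 (Nat.pair φ.code ψ.code)
  | .all x φ => Nat.pair 4 (Nat.pair (Encodable.encode x) φ.code)

theorem Term.code_inj {L : Sig} {σ : L.Srt} (t : Term L σ) :
    ∀ {τ : L.Srt} (u : Term L τ), t.code = u.code → σ = τ ∧ HEq t u := by
  induction t with
  | var σ i =>
    intro τ u h
    cases u with
    | var τ j =>
      simp only [Term.code, Nat.pair_eq_pair, Encodable.encode_inj] at h
      obtain ⟨-, rfl, rfl⟩ := h
      exact ⟨rfl, HEq.rfl⟩
    | app g b => simp [Term.code, Nat.pair_eq_pair] at h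
  | app f a ih =>
    intro τ u h
    cases u with
    | var τ j => simp [Term.code, Nat.pair_eq_pair] at h
    | app g b =>
      simp only [Term.code, Nat.pair_eq_pair, Encodable.encode_inj, true_and] at h
      obtain ⟨rfl, h⟩ := h
      have h' := List.ofFn_injective h
      have : a = b := funext fun k => eq_of_heq (ih k (b k) (congrFun h' k)).2
      subst this
      exact ⟨rfl, HEq.rfl⟩

theorem Fml.code_injective {L : Sig} : Function.Injective (Fml.code (L := L)) := by
  intro φ
  induction φ with
  | falsum => intro ψ h; cases ψ <;> simp [Fml.code, Nat.pair_eq_pair] at h ⊢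
  | eq t u =>
    intro ψ h
    cases ψ with
    | eq t' u' =>
      simp only [Fml.code, Nat.pair_eq_pair, true_and] at h
      obtain ⟨rfl, h1⟩ := t.code_inj t' h.1
      obtain ⟨-, h2⟩ := u.code_inj u' h.2
      rw [eq_of_heq h1, eq_of_heq h2]
    | _ => simp [Fml.code, Nat.pair_eq_pair] at h
  | rel P a =>
    intro ψ h
    cases ψ with
    | rel Q b =>
      simp only [Fml.code, Nat.pair_eq_pair, Encodable.encode_inj, true_and] at h
      obtain ⟨rfl, h⟩ := h
      have h' := List.ofFn_injective h
      rw [funext fun k => eq_of_heq ((a k).code_inj (b k) (congrFun h' k)).2]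
    | _ => simp [Fml.code, Nat.pair_eq_pair] at h
  | imp φ χ ih1 ih2 =>
    intro ψ h
    cases ψ with
    | imp φ' χ' =>
      simp only [Fml.code, Nat.pair_eq_pair, true_and] at h
      rw [ih1 h.1, ih2 h.2]
    | _ => simp [Fml.code, Nat.pair_eq_pair] at h
  | all x φ ih =>
    intro ψ h
    cases ψ with
    | all y φ' =>
      simp only [Fml.code, Nat.pair_eq_pair, Encodable.encode_inj, true_and] at h
      rw [h.1, ih h.2]
    | _ => simp [Fml.code, Nat.pair_eq_pair] at h

/-- A function from quantifier-free formulas to quantifier-free formulas is computable if it is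
tracked on Gödel numbers by a computable function on `ℕ`. -/
def QF.IsComputable {L : Sig} (wit : QF L → QF L) : Prop :=
  ∃ g : ℕ → ℕ, Computable g ∧ ∀ φ : QF L, g φ.1.code = (wit φ).1.code

universe u

/-- Structures, with non-empty domains; equality symbols are interpreted as the identity. -/
structure Struc (L : Sig) where
  dom : L.Srt → Type u
  nonempty : ∀ σ, Nonempty (dom σ)
  fn : (f : L.Fn) → ((k : Fin (L.fnAr f)) → dom (L.fnDom f k)) → dom (L.fnCod f)
  pr : (P : L.Pr) → ((k : Fin (L.prAr P)) → dom (L.prDom P k)) → Prop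

/-- Interpretations: a structure together with values for all variables. -/
structure Interp (L : Sig) extends Struc.{u} L where
  val : (x : L.Var) → dom x.1

/-- The value of a term in a structure under an assignment. -/
def Term.eval {L : Sig} (A : Struc.{u} L) (v : (x : L.Var) → A.dom x.1) :
    {σ : L.Srt} → Term L σ → A.dom σ
  | _, .var σ i => v (σ, i)
  | _, .app f args => A.fn f fun k => (args k).eval A v

/-- Satisfaction of a formula in a structure under an assignment. -/
def Fml.Sat {L : Sig} (A : Struc.{u} L) : Fml L → ((x : L.Var) → A.dom x.1) → Prop
  | .falsum, _ => False
  | .eq t u, v => t.eval A v = u.eval A v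
  | .rel P args, v => A.pr P fun k => (args k).eval A v
  | .imp φ ψ, v => φ.Sat A v → ψ.Sat A v
  | .all x φ, v => ∀ a : A.dom x.1, φ.Sat A (Function.update v x a)

/-- The interpretation `I` satisfies `φ`. -/
def Interp.Sat {L : Sig} (I : Interp.{u} L) (φ : Fml L) : Prop := φ.Sat I.toStruc I.val

/-- A theory, given by an axiomatization: a set of closed formulas. -/
structure Theory (L : Sig) where
  ax : Set (Fml L)
  closed : ∀ φ ∈ ax, φ.vars = ∅

namespace Theory

variable {L : Sig}

/-- The structure `A` is a model of `T`. -/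
def IsModel (T : Theory L) (A : Struc.{u} L) : Prop :=
  ∀ φ ∈ T.ax, ∀ v : (x : L.Var) → A.dom x.1, φ.Sat A v

/-- `I` is a `T`-interpretation. -/
def IsInterp (T : Theory L) (I : Interp.{u} L) : Prop := T.IsModel I.toStruc

def Satisfiable (T : Theory L) (φ : Fml L) : Prop := ∃ I : Interp.{u} L, T.IsInterp I ∧ I.Sat φ

def Valid (T : Theory L) (φ : Fml L) : Prop := ∀ I : Interp.{u} L, T.IsInterp I → I.Sat φ

/-- Equivalence of two formulas in all `T`-interpretations. -/
def Equivalent (T : Theory L) (φ ψ : Fml L) : Prop :=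
  ∀ I : Interp.{u} L, T.IsInterp I → (I.Sat φ ↔ I.Sat ψ)

def StablyInfinite (T : Theory L) (S : Set L.Srt) : Prop :=
  ∀ φ : QF L, Satisfiable.{u} T φ.1 →
    ∃ I : Interp.{u} L, T.IsInterp I ∧ I.Sat φ.1 ∧ ∀ σ ∈ S, Infinite (I.dom σ)

/-- Only the values of `κ` on `S` matter. -/
def Smooth (T : Theory L) (S : Set L.Srt) : Prop :=
  ∀ (φ : QF L) (I : Interp.{u} L), T.IsInterp I → I.Sat φ.1 →
    ∀ κ : L.Srt → Cardinal.{u}, (∀ σ ∈ S, Cardinal.mk (I.dom σ) ≤ κ σ) →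
      ∃ J : Interp.{u} L, T.IsInterp J ∧ J.Sat φ.1 ∧ ∀ σ ∈ S, Cardinal.mk (J.dom σ) = κ σ

/-- For every sort in `S`, the domain consists of the values of the free variables of `φ` of that
sort. -/
def _root_.ManySorted.Interp.IsCovered (I : Interp.{u} L) (φ : Fml L) (S : Set L.Srt) : Prop :=
  ∀ σ ∈ S, ∀ a : I.dom σ, ∃ i : ℕ, (σ, i) ∈ φ.vars ∧ I.val (σ, i) = a

/-- `φ` and `∃ w⃗, wit φ` are equivalent in `T`, where `w⃗` are the free variables of `wit φ` that
are not free in `φ`. -/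
def WitnessEquiv (T : Theory L) (wit : QF L → QF L) : Prop :=
  ∀ φ : QF L, Equivalent.{u} T φ.1 (Fml.exs ((wit φ).1.vars \ φ.1.vars).toList (wit φ).1)

def IsWitness (T : Theory L) (S : Set L.Srt) (wit : QF L → QF L) : Prop :=
  QF.IsComputable wit ∧ WitnessEquiv.{u} T wit ∧
    ∀ φ : QF L, Satisfiable.{u} T (wit φ).1 →
      ∃ I : Interp.{u} L, T.IsInterp I ∧ I.Sat (wit φ).1 ∧ I.IsCovered (wit φ).1 S

def IsStrongWitness (T : Theory L) (S : Set L.Srt) (wit : QF L → QF L) : Prop :=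
  QF.IsComputable wit ∧ WitnessEquiv.{u} T wit ∧
    ∀ (φ : QF L) (V : Finset L.Var) (E : L.Srt → Setoid ℕ), (∀ x ∈ V, x.1 ∈ S) →
      Satisfiable.{u} T ((wit φ).1.and (Fml.arrangement V E)) →
      ∃ I : Interp.{u} L, T.IsInterp I ∧ I.Sat ((wit φ).1.and (Fml.arrangement V E)) ∧
        I.IsCovered ((wit φ).1.and (Fml.arrangement V E)) S

def FinitelyWitnessable (T : Theory L) (S : Set L.Srt) : Prop :=
  ∃ wit : QF L → QF L, IsWitness.{u} T S wit

def StronglyFinitelyWitnessable (T : Theory L) (S : Set L.Srt) : Prop :=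
  ∃ wit : QF L → QF L, IsStrongWitness.{u} T S wit

/-- Convexity. The list `P` holds the pairs of variables `(u₁, v₁), …, (uₘ, vₘ)`, the entry
`(σ, i, j)` being the pair of the `i`-th and the `j`-th variable of sort `σ`; there is at least
one pair. -/
def Convex (T : Theory L) (S : Set L.Srt) : Prop :=
  ∀ (Γ : List (Fml L)) (P : List (L.Srt × ℕ × ℕ)), (∀ l ∈ Γ, l.IsLiteral) → P ≠ [] →
    (∀ p ∈ P, p.1 ∈ S) →
    Valid.{u} T ((Fml.bigAnd Γ).imp (Fml.bigOr (P.map fun p => Fml.eqVar p.1 p.2.1 p.2.2))) →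
    ∃ p ∈ P, Valid.{u} T ((Fml.bigAnd Γ).imp (Fml.eqVar p.1 p.2.1 p.2.2))

end Theory

/-- The empty signature with the `n` sorts `σ₁, …, σₙ`. -/
abbrev emptySig (n : ℕ) : Sig where
  Srt := Fin n
  Fn := Empty
  Pr := Empty
  fnAr := Empty.elim
  fnDom := fun f => f.elim
  fnCod := Empty.elim
  prAr := Empty.elim
  prDom := fun P => P.elim

/-- The signature with the `n` sorts `σ₁, …, σₙ` and one function symbol `s` of arity
`σ₁ → σ₁`. -/
abbrev unarySig (n : ℕ) (hn : 0 < n) : Sig where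
  Srt := Fin n
  Fn := Unit
  Pr := Empty
  fnAr := fun _ => 1
  fnDom := fun _ _ => ⟨0, hn⟩
  fnCod := fun _ => ⟨0, hn⟩
  prAr := Empty.elim
  prDom := fun P => P.elim

variable {n : ℕ} (hn : 0 < n)

/-- Terms over the empty signature, seen over the signature with `s`. -/
def Term.lift : {σ : (emptySig n).Srt} → Term (emptySig n) σ → Term (unarySig n hn) σ
  | _, .var σ i => Term.var (L := unarySig n hn) σ i
  | _, .app f _ => f.elim

/-- Formulas over the empty signature, seen over the signature with `s`. -/
def Fml.lift : Fml (emptySig n) → Fml (unarySig n hn)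
  | .falsum => .falsum
  | .eq t u => .eq (Term.lift hn t) (Term.lift hn u)
  | .rel P _ => P.elim
  | .imp φ ψ => .imp (Fml.lift φ) (Fml.lift ψ)
  | .all x φ => .all x (Fml.lift φ)

/-- The term `s(t)`. -/
def sTerm (t : Term (unarySig n hn) ⟨0, hn⟩) : Term (unarySig n hn) ⟨0, hn⟩ :=
  Term.app (L := unarySig n hn) () fun _ => t

/-- The sentence `∀ x, s²(x) = x ∨ s²(x) = s(x)`, with `x` of sort `σ₁`. -/
def psiVee : Fml (unarySig n hn) :=
  let x : Term (unarySig n hn) ⟨0, hn⟩ := Term.var _ 0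
  Fml.all (⟨0, hn⟩, 0)
    ((Fml.eq (sTerm hn (sTerm hn x)) x).or (Fml.eq (sTerm hn (sTerm hn x)) (sTerm hn x)))

theorem Term.vars_lift {σ : (emptySig n).Srt} (t : Term (emptySig n) σ) : (Term.lift hn t).vars = t.vars := by
  cases t with
  | var σ i => rfl
  | app f a => exact f.elim

theorem Fml.vars_lift (φ : Fml (emptySig n)) : (Fml.lift hn φ).vars = φ.vars := by
  induction φ with
  | falsum => rfl
  | eq t u => simp only [Fml.lift, Fml.vars, Term.vars_lift]
  | rel P a => exact P.elim
  | imp φ ψ h1 h2 => simp only [Fml.lift, Fml.vars, h1, h2]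
  | all x φ h => simp only [Fml.lift, Fml.vars, h]

theorem vars_psiVee : (psiVee hn).vars = ∅ := by
  ext x
  simp [psiVee, sTerm, Fml.or, Fml.neg, Fml.vars, Term.vars]

/-- The theory over the signature with `s` axiomatized by the axioms of `T` together with
`∀ x, s²(x) = x ∨ s²(x) = s(x)`. -/
def Theory.addVee (T : Theory (emptySig n)) : Theory (unarySig n hn) where
  ax := Fml.lift hn '' T.ax ∪ {psiVee hn}
  closed := by
    rintro φ (⟨ψ, hψ, rfl⟩ | rfl)
    · rw [Fml.vars_lift]; exact T.closed ψ hψ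
    · exact vars_psiVee hn

end ManySorted

/-! The axiom `psiVee` forces `s³ = s`: from either `s²(x) = x` or `s²(x) = s(x)` one gets `s³(x) =
s(x)`. Hence every term over `x` takes one of the values `x`, `s(x)`, `s²(x)`, and a quantifier-free
formula with variable indices below `N` can be flattened by naming these values with fresh variables
of sort `σ₁`. `Fml.flat` does so over the empty signature, adding `graphFml`, which says that the
named part of `s` is a well-defined function obeying the disjunction.

Two lemmas carry the transfer. `exists_sat_flat`: a model of the formula satisfies its flattening in
the reduct, after fresh variables receive values. `exists_sat_of_sat_flat`: a structure satisfying
the flattening expands by some `s`, with the same domains and assignment, to satisfy the formula;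
`s` follows the named graph and is the identity elsewhere. Domains never change, so stable infinity
and smoothness pass from `T` to `T.addVee hn`. In the other direction every model of `T` expands by
the identity.

For witnesses, one takes `wit (flat φ) ∧ φ` over the larger signature and `flat (wit φ ∧ φ)` over
the smaller one. Flattening is primitive recursive on Gödel numbers, so these are computable. Strong
witnesses for `T` also need that a quantifier-free formula over the empty signature depends only on
the equality pattern of its variables.

Convexity fails because `x₁ = s(x₀)` and `x₂ = s(x₁)` entail `x₂ = x₀ ∨ x₂ = x₁` but, with two
elements available, neither disjunct. -/

namespace ManySorted

universe u

/-! ### Semantics and free variables of the derived connectives, arrangements and finite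
conjunctions -/

section General

variable {L : Sig} {A : Struc.{u} L}

theorem Term.eval_congr {v w : (x : L.Var) → A.dom x.1} {σ : L.Srt} (t : Term L σ)
    (h : ∀ x ∈ t.vars, v x = w x) : t.eval A v = t.eval A w := by
  induction t with
  | var σ i => exact h (σ, i) (by simp [Term.vars])
  | app f a ih =>
    simp only [Term.eval]
    congr 1
    funext k
    exact ih k fun x hx => h x (by simpa [Term.vars] using ⟨k, hx⟩)

theorem Term.mem_vars_app {f : L.Fn} {a : (k : Fin (L.fnAr f)) → Term L (L.fnDom f k)}
    {x : L.Var} : x ∈ (Term.app f a).vars ↔ ∃ k, x ∈ (a k).vars := by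
  simp [Term.vars]

theorem Term.mem_vars_var {σ : L.Srt} {i : ℕ} {x : L.Var} :
    x ∈ (Term.var σ i : Term L σ).vars ↔ x = (σ, i) := Finset.mem_singleton

namespace Fml

@[simp] theorem sat_neg (φ : Fml L) (v : (x : L.Var) → A.dom x.1) :
    φ.neg.Sat A v ↔ ¬ φ.Sat A v := Iff.rfl

@[simp] theorem sat_or (φ ψ : Fml L) (v : (x : L.Var) → A.dom x.1) :
    (φ.or ψ).Sat A v ↔ φ.Sat A v ∨ ψ.Sat A v := by
  simp only [Fml.or, Fml.Sat, sat_neg]; tauto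

@[simp] theorem sat_and (φ ψ : Fml L) (v : (x : L.Var) → A.dom x.1) :
    (φ.and ψ).Sat A v ↔ φ.Sat A v ∧ ψ.Sat A v := by
  simp only [Fml.and, Fml.Sat, sat_neg]; tauto

@[simp] theorem sat_verum (v : (x : L.Var) → A.dom x.1) : (verum : Fml L).Sat A v :=
  fun h => h

theorem sat_ex (x : L.Var) (φ : Fml L) (v : (x : L.Var) → A.dom x.1) :
    (ex x φ).Sat A v ↔ ∃ a, φ.Sat A (Function.update v x a) := by
  simp only [ex, Fml.Sat, sat_neg]; simp

theorem sat_bigAnd (l : List (Fml L)) (v : (x : L.Var) → A.dom x.1) :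
    (bigAnd l).Sat A v ↔ ∀ φ ∈ l, φ.Sat A v := by
  induction l with
  | nil => simp [bigAnd]
  | cons φ l ih => simp [bigAnd, ih]

theorem sat_eqVar (σ : L.Srt) (i j : ℕ) (v : (x : L.Var) → A.dom x.1) :
    (eqVar σ i j).Sat A v ↔ v (σ, i) = v (σ, j) := Iff.rfl

@[simp] theorem vars_neg (φ : Fml L) : φ.neg.vars = φ.vars := by simp [neg, vars]

@[simp] theorem vars_or (φ ψ : Fml L) : (φ.or ψ).vars = φ.vars ∪ ψ.vars := by
  simp [Fml.or, vars]

@[simp] theorem vars_and (φ ψ : Fml L) : (φ.and ψ).vars = φ.vars ∪ ψ.vars := by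
  simp [Fml.and, vars]

theorem mem_vars_eq {σ : L.Srt} {t u : Term L σ} {x : L.Var} :
    x ∈ (Fml.eq t u).vars ↔ x ∈ t.vars ∨ x ∈ u.vars := Finset.mem_union

theorem mem_vars_imp {φ ψ : Fml L} {x : L.Var} :
    x ∈ (φ.imp ψ).vars ↔ x ∈ φ.vars ∨ x ∈ ψ.vars := Finset.mem_union

theorem mem_vars_and {φ ψ : Fml L} {x : L.Var} :
    x ∈ (φ.and ψ).vars ↔ x ∈ φ.vars ∨ x ∈ ψ.vars := by rw [vars_and, Finset.mem_union]

theorem mem_vars_or {φ ψ : Fml L} {x : L.Var} :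
    x ∈ (φ.or ψ).vars ↔ x ∈ φ.vars ∨ x ∈ ψ.vars := by rw [vars_or, Finset.mem_union]

theorem mem_vars_bigAnd (l : List (Fml L)) (x : L.Var) :
    x ∈ (bigAnd l).vars ↔ ∃ φ ∈ l, x ∈ φ.vars := by
  induction l with
  | nil => simp [bigAnd, verum, vars]
  | cons φ l ih => simp [bigAnd, ih]

theorem vars_eqVar (σ : L.Srt) (i j : ℕ) : (eqVar σ i j).vars = {(σ, i), (σ, j)} := rfl

theorem mem_vars_eqVar_right (σ : L.Srt) (i j : ℕ) : (σ, j) ∈ (eqVar σ i j).vars := by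
  simp [vars_eqVar]

@[simp] theorem isQF_neg (φ : Fml L) : φ.neg.IsQF ↔ φ.IsQF := by simp [neg, IsQF]

@[simp] theorem isQF_or (φ ψ : Fml L) : (φ.or ψ).IsQF ↔ φ.IsQF ∧ ψ.IsQF := by
  simp [Fml.or, IsQF]

@[simp] theorem isQF_and (φ ψ : Fml L) : (φ.and ψ).IsQF ↔ φ.IsQF ∧ ψ.IsQF := by
  simp [Fml.and, IsQF]

theorem isQF_bigAnd (l : List (Fml L)) (h : ∀ φ ∈ l, φ.IsQF) : (bigAnd l).IsQF := by
  induction l with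
  | nil => simp [bigAnd, verum, IsQF]
  | cons φ l ih =>
    simp only [List.mem_cons, forall_eq_or_imp] at h
    simpa [bigAnd] using ⟨h.1, ih h.2⟩

theorem sat_congr (φ : Fml L) {v w : (x : L.Var) → A.dom x.1} (h : ∀ x ∈ φ.vars, v x = w x) :
    φ.Sat A v ↔ φ.Sat A w := by
  induction φ generalizing v w with
  | falsum => rfl
  | eq t t' =>
    simp only [Sat]
    rw [t.eval_congr fun x hx => h x (by simp [vars, hx]),
      t'.eval_congr fun x hx => h x (by simp [vars, hx])]
  | rel P a =>
    simp only [Sat]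
    rw [funext fun k => (a k).eval_congr (v := v) (w := w) fun x hx =>
      h x (by simpa [vars] using ⟨k, hx⟩)]
  | imp φ ψ h1 h2 =>
    simp only [Sat]
    rw [h1 fun x hx => h x (by simp [vars, hx]), h2 fun x hx => h x (by simp [vars, hx])]
  | all y φ ih =>
    refine forall_congr' fun a => ih fun x hx => ?_
    by_cases hxy : x = y
    · subst hxy; simp
    · simp only [Function.update_of_ne hxy]
      exact h x (by simp [vars, hx, hxy])

theorem sat_exs (l : List L.Var) (φ : Fml L) (v : (x : L.Var) → A.dom x.1) :
    (exs l φ).Sat A v ↔ ∃ w, (∀ x ∉ l, w x = v x) ∧ φ.Sat A w := by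
  induction l generalizing v with
  | nil =>
    refine ⟨fun h => ⟨v, fun _ _ => rfl, h⟩, ?_⟩
    rintro ⟨w, hw, h⟩
    obtain rfl : w = v := funext fun x => hw x (by simp)
    exact h
  | cons y l ih =>
    simp only [exs, sat_ex, ih]
    constructor
    · rintro ⟨a, w, hw, h⟩
      refine ⟨w, fun x hx => ?_, h⟩
      simp only [List.mem_cons, not_or] at hx
      rw [hw x hx.2, Function.update_of_ne hx.1]
    · rintro ⟨w, hw, h⟩
      refine ⟨w y, w, fun x hx => ?_, h⟩
      by_cases hxy : x = y
      · subst hxy; simp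
      · rw [Function.update_of_ne hxy]
        exact hw x (by simp [hxy, hx])

/-- Variables outside both `X` and `φ.vars` cannot influence `φ`, so the new assignment need only be
controlled on `X`. This form spares the witness arguments any list of quantified variables. -/
theorem sat_exs_vars_sdiff (φ : Fml L) (X : Finset L.Var) (v : (x : L.Var) → A.dom x.1) :
    (exs (φ.vars \ X).toList φ).Sat A v ↔ ∃ w, (∀ x ∈ X, w x = v x) ∧ φ.Sat A w := by
  rw [sat_exs]
  constructor
  · rintro ⟨w, hw, h⟩
    exact ⟨w, fun x hx => hw x (by simp [hx]), h⟩
  · rintro ⟨w, hw, h⟩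
    classical
    refine ⟨fun x => if x ∈ φ.vars \ X then w x else v x, fun x hx => ?_, ?_⟩
    · rw [Finset.mem_toList] at hx
      exact if_neg hx
    · refine (sat_congr φ fun x hx => ?_).1 h
      by_cases hX : x ∈ X
      · simp [hX, hw x hX]
      · simp [hX, hx]

theorem sat_arrangement (V : Finset L.Var) (E : L.Srt → Setoid ℕ) (v : (x : L.Var) → A.dom x.1) :
    (arrangement V E).Sat A v ↔ ∀ σ i j, (σ, i) ∈ V → (σ, j) ∈ V →
      (v (σ, i) = v (σ, j) ↔ E σ i j) := by
  -- The decidability instance is arbitrary so that the claim applies to the classical one inside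
  -- `arrangement`.
  have key : ∀ (σ : L.Srt) (i j : ℕ) [Decidable (E σ i j)],
      (if E σ i j then eqVar σ i j else (eqVar σ i j).neg).Sat A v ↔
        (v (σ, i) = v (σ, j) ↔ E σ i j) := by
    intro σ i j _
    split_ifs with h <;> simp [sat_eqVar, h]
  rw [arrangement, sat_bigAnd]
  classical
  constructor
  · intro h σ i j hi hj
    exact (key σ i j).1 (h _ (List.mem_map.2 ⟨((σ, i), (σ, j)), by simp [hi, hj], rfl⟩))
  · intro h φ hφ
    obtain ⟨⟨⟨σ, i⟩, ⟨τ, j⟩⟩, hp, rfl⟩ := List.mem_map.1 hφ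
    simp only [Finset.mem_toList, Finset.mem_filter, Finset.mem_product] at hp
    obtain ⟨⟨hi, hj⟩, rfl⟩ := hp
    exact (key _ i j).2 (h _ i j hi hj)

theorem vars_arrangement (V : Finset L.Var) (E : L.Srt → Setoid ℕ) :
    (arrangement V E).vars = V := by
  have key : ∀ (σ : L.Srt) (i j : ℕ) [Decidable (E σ i j)],
      (if E σ i j then eqVar σ i j else (eqVar σ i j).neg).vars = {(σ, i), (σ, j)} := by
    intro σ i j _
    split_ifs with h <;> simp [vars_eqVar]
  ext ⟨σ, i⟩
  rw [arrangement, mem_vars_bigAnd]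
  constructor
  · rintro ⟨φ, hφ, hx⟩
    obtain ⟨⟨⟨τ, k⟩, ⟨τ', j⟩⟩, hp, rfl⟩ := List.mem_map.1 hφ
    simp only [Finset.mem_toList, Finset.mem_filter, Finset.mem_product] at hp
    obtain ⟨⟨hi, hj⟩, rfl⟩ := hp
    rw [key] at hx
    simp only [Finset.mem_insert, Finset.mem_singleton] at hx
    rcases hx with hx | hx <;> rw [hx] <;> assumption
  · intro hx
    refine ⟨_, List.mem_map.2 ⟨((σ, i), (σ, i)), by simp [hx], rfl⟩, ?_⟩
    rw [key]; simp

theorem isQF_arrangement (V : Finset L.Var) (E : L.Srt → Setoid ℕ) : (arrangement V E).IsQF := by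
  refine isQF_bigAnd _ fun φ hφ => ?_
  obtain ⟨p, -, rfl⟩ := List.mem_map.1 hφ
  split_ifs <;> simp [eqVar, IsQF]

/-- The conjunction of `f i` for `i < k`. -/
def allLt : ℕ → (ℕ → Fml L) → Fml L
  | 0, _ => verum
  | k + 1, f => (f k).and (allLt k f)

theorem sat_allLt (k : ℕ) (f : ℕ → Fml L) (v : (x : L.Var) → A.dom x.1) :
    (allLt k f).Sat A v ↔ ∀ i < k, (f i).Sat A v := by
  induction k with
  | zero => simp [allLt]
  | succ k ih =>
    rw [allLt, sat_and, ih]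
    exact ⟨fun h i hi => (Nat.lt_succ_iff_lt_or_eq.1 hi).elim (h.2 i) fun e => e ▸ h.1,
      fun h => ⟨h k k.lt_succ_self, fun i hi => h i (hi.trans k.lt_succ_self)⟩⟩

theorem isQF_allLt (k : ℕ) (f : ℕ → Fml L) (h : ∀ i, (f i).IsQF) : (allLt k f).IsQF := by
  induction k with
  | zero => simp [allLt, verum, IsQF]
  | succ k ih => simp [allLt, ih, h]

theorem vars_subset_vars_allLt {k i : ℕ} (hi : i < k) (f : ℕ → Fml L) :
    (f i).vars ⊆ (allLt k f).vars := by
  induction k with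
  | zero => omega
  | succ k ih =>
    rw [allLt, vars_and]
    rcases Nat.lt_succ_iff_lt_or_eq.1 hi with h | rfl
    · exact (ih h).trans Finset.subset_union_right
    · exact Finset.subset_union_left

end Fml

/-! ### Gödel numbers bound variable indices -/

theorem le_encode_of_mem {l : List ℕ} {c : ℕ} (hc : c ∈ l) : c ≤ Encodable.encode l := by
  induction l with
  | nil => simp at hc
  | cons b l ih =>
    rw [Encodable.encode_list_cons]
    rcases List.mem_cons.1 hc with rfl | hc
    · exact (Nat.left_le_pair _ _).trans (Nat.le_succ _)
    · exact (ih hc).trans ((Nat.right_le_pair _ _).trans (Nat.le_succ _))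

theorem Term.le_code_of_mem_vars {σ : L.Srt} (t : Term L σ) {x : L.Var} (hx : x ∈ t.vars) :
    x.2 ≤ t.code := by
  induction t with
  | var σ i =>
    simp only [Term.vars, Finset.mem_singleton] at hx
    subst hx
    exact (Nat.right_le_pair _ _).trans (Nat.right_le_pair _ _)
  | app f a ih =>
    simp only [Term.vars, Finset.mem_biUnion, Finset.mem_univ, true_and] at hx
    obtain ⟨k, hk⟩ := hx
    refine (ih k hk).trans (le_trans ?_ ((Nat.right_le_pair _ _).trans (Nat.right_le_pair _ _)))
    exact le_encode_of_mem (List.mem_ofFn.2 ⟨k, rfl⟩)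

/-- This lets the code of `φ` itself serve as the bound `N` beyond which indices are fresh, so
flattening need not compute the set of variables. -/
theorem Fml.IsQF.lt_code_of_mem_vars {φ : Fml L} (h : φ.IsQF) {x : L.Var} (hx : x ∈ φ.vars) :
    x.2 < φ.code := by
  -- Strictness comes from the positive constructor tag `k`, since `k + b ≤ Nat.pair k b`.
  have key : ∀ {k a b : ℕ}, 0 < k → a ≤ b → a < Nat.pair k b := fun hk hab => by
    exact lt_of_lt_of_le (by omega) (Nat.add_le_pair _ _)
  induction φ with
  | falsum => simp [vars] at hx
  | eq t u =>
    refine key one_pos ?_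
    rcases Finset.mem_union.1 hx with hx | hx
    · exact (t.le_code_of_mem_vars hx).trans (Nat.left_le_pair _ _)
    · exact (u.le_code_of_mem_vars hx).trans (Nat.right_le_pair _ _)
  | rel P a =>
    simp only [vars, Finset.mem_biUnion, Finset.mem_univ, true_and] at hx
    obtain ⟨k, hk⟩ := hx
    refine key two_pos (((a k).le_code_of_mem_vars hk).trans
      (le_trans ?_ (Nat.right_le_pair _ _)))
    exact le_encode_of_mem (List.mem_ofFn.2 ⟨k, rfl⟩)
  | imp φ ψ h1 h2 =>
    refine key (by decide) ?_
    rcases Finset.mem_union.1 hx with hx | hx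
    · exact (h1 h.1 hx).le.trans (Nat.left_le_pair _ _)
    · exact (h2 h.2 hx).le.trans (Nat.right_le_pair _ _)
  | all y φ _ => exact h.elim

end General

/-! ### Reducts, expansions and the models of the extended theory -/

section Unary

variable {n : ℕ} {hn : 0 < n}

/-- The reduct of a structure to the empty signature. -/
abbrev Struc.reduct (A : Struc.{u} (unarySig n hn)) : Struc.{u} (emptySig n) where
  dom := A.dom
  nonempty := A.nonempty
  fn := fun f => f.elim
  pr := fun P => P.elim

/-- The function interpreting `s`. -/
def Struc.succ (A : Struc.{u} (unarySig n hn)) (a : A.dom ⟨0, hn⟩) : A.dom ⟨0, hn⟩ :=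
  A.fn () fun _ => a

/-- The expansion of a structure over the empty signature by an interpretation of `s`. -/
abbrev Struc.expand (A : Struc.{u} (emptySig n)) (s : A.dom ⟨0, hn⟩ → A.dom ⟨0, hn⟩) :
    Struc.{u} (unarySig n hn) where
  dom := A.dom
  nonempty := A.nonempty
  fn := fun _ a => s (a 0)
  pr := fun P => P.elim

theorem Fml.sat_reduct_expand (φ : Fml (emptySig n)) (B : Struc.{u} (emptySig n))
    (s : B.dom ⟨0, hn⟩ → B.dom ⟨0, hn⟩) (v : (x : (emptySig n).Var) → B.dom x.1) :
    φ.Sat (B.expand s).reduct v ↔ φ.Sat B v := by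
  -- The empty families of symbols of `B` agree with those of the reduct only propositionally; once
  -- they are substituted the claim is definitional.
  obtain ⟨d, ne, f, p⟩ := B
  obtain rfl : f = fun f => f.elim := funext fun f => f.elim
  obtain rfl : p = fun P => P.elim := funext fun P => P.elim
  rfl

theorem Fml.sat_lift (φ : Fml (emptySig n)) (A : Struc.{u} (unarySig n hn))
    (v : (x : (unarySig n hn).Var) → A.dom x.1) :
    (Fml.lift hn φ).Sat A v ↔ φ.Sat A.reduct v := by
  have key : ∀ (v : (x : (unarySig n hn).Var) → A.dom x.1) (σ : Fin n)
      (t : Term (emptySig n) σ), (Term.lift hn t).eval A v = t.eval A.reduct v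
    | _, _, .var _ _ => rfl
    | _, _, .app f _ => f.elim
  induction φ generalizing v with
  | falsum => rfl
  | eq t u => simp only [Fml.lift, Fml.Sat, key]
  | rel P a => exact P.elim
  | imp φ ψ h1 h2 => exact imp_congr (h1 v) (h2 v)
  | all x φ ih => exact forall_congr' fun a => ih _

theorem Fml.isQF_lift {φ : Fml (emptySig n)} (h : φ.IsQF) : (Fml.lift hn φ).IsQF := by
  induction φ with
  | falsum => trivial
  | eq t u => trivial
  | rel P a => exact P.elim
  | imp φ ψ h1 h2 => exact ⟨h1 h.1, h2 h.2⟩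
  | all x φ ih => exact h

theorem Theory.isModel_addVee (T : Theory (emptySig n)) (A : Struc.{u} (unarySig n hn)) :
    (T.addVee hn).IsModel A ↔ T.IsModel A.reduct ∧
      ∀ a, A.succ (A.succ a) = a ∨ A.succ (A.succ a) = A.succ a := by
  have key : ∀ v : (x : (unarySig n hn).Var) → A.dom x.1, (psiVee hn).Sat A v ↔
      ∀ a, A.succ (A.succ a) = a ∨ A.succ (A.succ a) = A.succ a := by
    intro v
    refine forall_congr' fun a => ?_
    rw [Fml.sat_or]
    simp [Fml.Sat, sTerm, Term.eval, Struc.succ]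
  have hv : Nonempty ((x : (unarySig n hn).Var) → A.dom x.1) :=
    ⟨fun x => (A.nonempty x.1).some⟩
  constructor
  · intro h
    refine ⟨fun φ hφ v => ?_, (key hv.some).1 (h _ (Or.inr rfl) _)⟩
    exact (Fml.sat_lift φ A v).1 (h _ (Or.inl ⟨φ, hφ, rfl⟩) v)
  · rintro ⟨h1, h2⟩ φ (⟨ψ, hψ, rfl⟩ | rfl) v
    · exact (Fml.sat_lift ψ A v).2 (h1 ψ hψ v)
    · exact (key v).2 h2

/-! ### Flattening: syntax -/

/-- The index of the variable standing for `s xⱼ`: the variables with indices in `[N, 2N)` name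
the values of `s` and those with indices in `[2N, 3N)` the values of `s ∘ s`. -/
def succIdx (N j : ℕ) : ℕ := if j < 2 * N then j + N else j - N

/-- The three blocks are closed under the successor index because `s³ = s`: the third block, naming
`s²(x)`, is sent back to the second, naming `s(x)`. -/
theorem succIdx_lt {N j : ℕ} (h : j < 3 * N) : succIdx N j < 3 * N := by
  unfold succIdx; split_ifs <;> omega

/-- The index of the variable that replaces a term. -/
def Term.flatIdx (N : ℕ) : {σ : (unarySig n hn).Srt} → Term (unarySig n hn) σ → ℕ
  | _, .var _ i => i
  | _, .app _ a => succIdx N ((a 0).flatIdx N)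

/-- The variable that replaces a term. -/
def Term.flat (N : ℕ) {σ : (unarySig n hn).Srt} (t : Term (unarySig n hn) σ) :
    Term (emptySig n) σ :=
  Term.var (L := emptySig n) σ (t.flatIdx N)

/-- Replacement of all terms by variables in a quantifier-free formula. -/
def Fml.flatCore (N : ℕ) : Fml (unarySig n hn) → Fml (emptySig n)
  | .falsum => .falsum
  | .eq t u => .eq (t.flat N) (u.flat N)
  | .rel P _ => P.elim
  | .imp φ ψ => .imp (φ.flatCore N) (ψ.flatCore N)
  | .all _ _ => .falsum

/-- The map `xⱼ ↦ x_(succIdx N j)` for `j < 3N` is well defined on values and satisfies the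
disjunction defining `psiVee`. -/
def graphFml (hn : 0 < n) (N : ℕ) : Fml (emptySig n) :=
  let e : ℕ → ℕ → Fml (emptySig n) := Fml.eqVar (L := emptySig n) ⟨0, hn⟩
  Fml.allLt (3 * N) fun j =>
    ((e (succIdx N (succIdx N j)) j).or (e (succIdx N (succIdx N j)) (succIdx N j))).and
      (Fml.allLt (3 * N) fun k => (e j k).imp (e (succIdx N j) (succIdx N k)))

/-- A formula over the empty signature that is satisfied by a reduct, for suitable values of new
variables, exactly when the given formula is. -/
def Fml.flat (φ : Fml (unarySig n hn)) : Fml (emptySig n) :=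
  (φ.flatCore φ.code).and (graphFml hn φ.code)

theorem Fml.isQF_flatCore (N : ℕ) (φ : Fml (unarySig n hn)) : (φ.flatCore N).IsQF := by
  induction φ with
  | rel P a => exact P.elim
  | imp φ ψ h1 h2 => exact ⟨h1, h2⟩
  | _ => trivial

theorem isQF_graphFml (N : ℕ) : (graphFml hn N).IsQF :=
  Fml.isQF_allLt _ _ fun j => by
    simp only [Fml.isQF_and, Fml.isQF_or]
    exact ⟨⟨trivial, trivial⟩, Fml.isQF_allLt _ _ fun k => ⟨trivial, trivial⟩⟩

theorem Fml.isQF_flat (φ : Fml (unarySig n hn)) : φ.flat.IsQF := by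
  rw [Fml.flat, Fml.isQF_and]
  exact ⟨φ.isQF_flatCore _, isQF_graphFml _⟩

theorem sat_graphFml (N : ℕ) (A : Struc.{u} (emptySig n))
    (v : (x : (emptySig n).Var) → A.dom x.1) :
    (graphFml hn N).Sat A v ↔ ∀ j < 3 * N,
      (v (⟨0, hn⟩, succIdx N (succIdx N j)) = v (⟨0, hn⟩, j) ∨
        v (⟨0, hn⟩, succIdx N (succIdx N j)) = v (⟨0, hn⟩, succIdx N j)) ∧
      ∀ k < 3 * N, v (⟨0, hn⟩, j) = v (⟨0, hn⟩, k) →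
        v (⟨0, hn⟩, succIdx N j) = v (⟨0, hn⟩, succIdx N k) := by
  simp only [graphFml, Fml.sat_allLt, Fml.sat_and, Fml.sat_or]
  rfl

theorem Term.mem_vars_flat {N : ℕ} {σ : (unarySig n hn).Srt} (t : Term (unarySig n hn) σ)
    {x : (unarySig n hn).Var} (hx : x ∈ t.vars) (h0 : x.1 ≠ ⟨0, hn⟩) : x ∈ (t.flat N).vars := by
  induction t with
  | var σ i => exact hx
  | app f a ih =>
    obtain ⟨k, hk⟩ := Term.mem_vars_app.1 hx
    exact absurd (congrArg Prod.fst (Term.mem_vars_var.1 (ih k hk))) h0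

theorem Fml.IsQF.mem_vars_flatCore {N : ℕ} {φ : Fml (unarySig n hn)} (h : φ.IsQF)
    {x : (unarySig n hn).Var} (hx : x ∈ φ.vars) (h0 : x.1 ≠ ⟨0, hn⟩) :
    x ∈ (φ.flatCore N).vars := by
  induction φ with
  | falsum => simp [Fml.vars] at hx
  | eq t u =>
    rcases Fml.mem_vars_eq.1 hx with hx | hx
    · exact Fml.mem_vars_eq.2 (Or.inl <| t.mem_vars_flat hx h0)
    · exact Fml.mem_vars_eq.2 (Or.inr <| u.mem_vars_flat hx h0)
  | rel P a => exact P.elim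
  | imp φ ψ h1 h2 =>
    rcases Fml.mem_vars_imp.1 hx with hx | hx
    · exact Fml.mem_vars_imp.2 (Or.inl <| h1 h.1 hx)
    · exact Fml.mem_vars_imp.2 (Or.inr <| h2 h.2 hx)
  | all y φ _ => exact h.elim

/-- A variable of sort `σ₁` occurring only under `s` disappears from `flatCore`, but `graphFml`
mentions every index below `3N` of that sort. Variables of other sorts are never under `s` and
survive in `flatCore`. -/
theorem Fml.IsQF.vars_subset_flat {φ : Fml (unarySig n hn)} (h : φ.IsQF) :
    φ.vars ⊆ φ.flat.vars := by
  intro x hx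
  rw [Fml.flat, Fml.mem_vars_and]
  by_cases h0 : x.1 = ⟨0, hn⟩
  · right
    have hlt := h.lt_code_of_mem_vars hx
    refine Fml.vars_subset_vars_allLt (i := x.2) (by omega) _ ?_
    obtain ⟨σ, i⟩ := x
    subst h0
    exact Fml.mem_vars_and.2 (Or.inl (Fml.mem_vars_or.2 (Or.inl (Fml.mem_vars_eqVar_right _ _ _))))
  · exact Or.inl (h.mem_vars_flatCore hx h0)

/-! ### Flattening: passing between a formula and its flattened form -/

section Semantics

variable {N : ℕ} {A : Struc.{u} (unarySig n hn)} {v : (x : (unarySig n hn).Var) → A.dom x.1}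

theorem Term.flatIdx_lt {σ : (unarySig n hn).Srt} (t : Term (unarySig n hn) σ)
    (ht : ∀ x ∈ t.vars, x.2 < N) : t.flatIdx N < 3 * N := by
  induction t with
  | var σ i =>
    have := ht (σ, i) (Term.mem_vars_var.2 rfl)
    simp only [Term.flatIdx]; omega
  | app f a ih =>
    exact succIdx_lt (ih 0 fun x hx => ht x (Term.mem_vars_app.2 ⟨0, hx⟩))

theorem Term.eval_flat (hv : ∀ j < 3 * N, v (⟨0, hn⟩, succIdx N j) = A.succ (v (⟨0, hn⟩, j)))
    {σ : (unarySig n hn).Srt} (t : Term (unarySig n hn) σ) (ht : ∀ x ∈ t.vars, x.2 < N) :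
    (t.flat N).eval A.reduct v = t.eval A v := by
  induction t with
  | var σ i => rfl
  | app f a ih =>
    have h0 : ∀ x ∈ (a 0).vars, x.2 < N := fun x hx => ht x (Term.mem_vars_app.2 ⟨0, hx⟩)
    refine (hv _ ((a 0).flatIdx_lt h0)).trans ?_
    refine congrArg (A.fn ()) (funext fun k => ?_)
    obtain rfl : k = 0 := Subsingleton.elim _ _
    exact ih 0 h0

theorem Fml.IsQF.sat_flatCore
    (hv : ∀ j < 3 * N, v (⟨0, hn⟩, succIdx N j) = A.succ (v (⟨0, hn⟩, j)))
    {φ : Fml (unarySig n hn)} (h : φ.IsQF) (hφ : ∀ x ∈ φ.vars, x.2 < N) :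
    (φ.flatCore N).Sat A.reduct v ↔ φ.Sat A v := by
  induction φ with
  | falsum => rfl
  | eq t u =>
    simp only [Fml.flatCore, Fml.Sat]
    rw [Term.eval_flat hv t fun x hx => hφ x (Fml.mem_vars_eq.2 (Or.inl hx)),
      Term.eval_flat hv u fun x hx => hφ x (Fml.mem_vars_eq.2 (Or.inr hx))]
  | rel P a => exact P.elim
  | imp φ ψ h1 h2 =>
    simp only [Fml.flatCore, Fml.Sat]
    rw [h1 h.1 fun x hx => hφ x (Fml.mem_vars_imp.2 (Or.inl hx)),
      h2 h.2 fun x hx => hφ x (Fml.mem_vars_imp.2 (Or.inr hx))]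
  | all y φ _ => exact h.elim

/-- The fresh variables are given the values they are meant to name. Since `N` exceeds all indices
in `φ`, this leaves the variables of `φ` untouched. -/
theorem Fml.IsQF.exists_sat_flat
    (hA : ∀ a, A.succ (A.succ a) = a ∨ A.succ (A.succ a) = A.succ a)
    {φ : Fml (unarySig n hn)} (h : φ.IsQF) (hs : φ.Sat A v) :
    ∃ w : (x : (unarySig n hn).Var) → A.dom x.1, (∀ x ∈ φ.vars, w x = v x) ∧
      φ.flat.Sat A.reduct w := by
  obtain ⟨N, hN⟩ : ∃ N, N = φ.code := ⟨_, rfl⟩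
  -- Indices of sort `σ₁` from `2N` on all take the last branch; those from `3N` on are irrelevant.
  let w : (x : (unarySig n hn).Var) → A.dom x.1 := fun x =>
    if hx : x.1 = ⟨0, hn⟩ ∧ N ≤ x.2 then
      if x.2 < 2 * N then hx.1 ▸ A.succ (v (⟨0, hn⟩, x.2 - N))
      else hx.1 ▸ A.succ (A.succ (v (⟨0, hn⟩, x.2 - 2 * N)))
    else v x
  have w0 : ∀ x : (unarySig n hn).Var, x.2 < N → w x = v x := fun x hx =>
    dif_neg (by omega)
  have w1 : ∀ j < N, w (⟨0, hn⟩, j + N) = A.succ (v (⟨0, hn⟩, j)) := fun j hj => by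
    simp only [w]
    rw [dif_pos ⟨trivial, by omega⟩, if_pos (by omega), Nat.add_sub_cancel]
  have w2 : ∀ j < N, w (⟨0, hn⟩, j + 2 * N) = A.succ (A.succ (v (⟨0, hn⟩, j))) := fun j hj => by
    simp only [w]
    rw [dif_pos ⟨trivial, by omega⟩, if_neg (by omega), Nat.add_sub_cancel]
  have hw : ∀ j < 3 * N, w (⟨0, hn⟩, succIdx N j) = A.succ (w (⟨0, hn⟩, j)) := by
    intro j hj
    unfold succIdx
    by_cases h1 : j < N
    · rw [if_pos (by omega), w1 j h1, w0 _ h1]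
    by_cases h2 : j < 2 * N
    · obtain ⟨i, rfl⟩ : ∃ i, j = i + N := ⟨j - N, by omega⟩
      rw [if_pos h2, w1 i (by omega), show i + N + N = i + 2 * N by ring, w2 i (by omega)]
    · obtain ⟨i, rfl⟩ : ∃ i, j = i + 2 * N := ⟨j - 2 * N, by omega⟩
      rw [if_neg h2, show i + 2 * N - N = i + N by omega, w1 i (by omega), w2 i (by omega)]
      -- This is `s³ = s`, read off from either disjunct.
      rcases hA (v (⟨0, hn⟩, i)) with e | e <;> simp only [e]
  have hlt : ∀ x ∈ φ.vars, x.2 < N := fun x hx => hN ▸ h.lt_code_of_mem_vars hx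
  have hwv : ∀ x ∈ φ.vars, w x = v x := fun x hx => w0 x (hlt x hx)
  refine ⟨w, hwv, ?_⟩
  subst hN
  refine (Fml.sat_and (A := A.reduct) _ _ w).2 ⟨(h.sat_flatCore hw hlt).2 ((Fml.sat_congr φ hwv).2 hs), ?_⟩
  refine (sat_graphFml _ A.reduct w).2 fun j hj => ⟨?_, fun k hk e => ?_⟩
  · rw [hw _ (succIdx_lt hj), hw _ hj]
    exact hA _
  · rw [hw _ hj, hw _ hk, e]

/-- The congruence clauses of `graphFml` make `x_j ↦ x_(succIdx N j)` a function on the named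
values, and its disjunctions give the axiom there. The assignment and domains are kept, so
cardinalities and covering by variables are preserved. -/
theorem Fml.IsQF.exists_sat_of_sat_flat {B : Struc.{u} (emptySig n)}
    {v : (x : (emptySig n).Var) → B.dom x.1} {φ : Fml (unarySig n hn)} (h : φ.IsQF)
    (hs : φ.flat.Sat B v) :
    ∃ s : B.dom ⟨0, hn⟩ → B.dom ⟨0, hn⟩, (∀ a, s (s a) = a ∨ s (s a) = s a) ∧
      φ.Sat (B.expand s) v := by
  rw [Fml.flat, Fml.sat_and, sat_graphFml] at hs
  obtain ⟨hc, hg⟩ := hs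
  obtain ⟨N, hN⟩ : ∃ N, N = φ.code := ⟨_, rfl⟩
  rw [← hN] at hc hg
  classical
  -- An index naming `a` is chosen arbitrarily, which is harmless by the congruence clauses. On
  -- unnamed elements the identity satisfies the first disjunct.
  let s : B.dom ⟨0, hn⟩ → B.dom ⟨0, hn⟩ := fun a =>
    if ha : ∃ j, j < 3 * N ∧ v (⟨0, hn⟩, j) = a then v (⟨0, hn⟩, succIdx N ha.choose) else a
  have s1 : ∀ j < 3 * N, v (⟨0, hn⟩, succIdx N j) = s (v (⟨0, hn⟩, j)) := by
    intro j hj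
    have ha : ∃ k, k < 3 * N ∧ v (⟨0, hn⟩, k) = v (⟨0, hn⟩, j) := ⟨j, hj, rfl⟩
    simp only [s]
    rw [dif_pos ha]
    exact (hg j hj).2 _ ha.choose_spec.1 ha.choose_spec.2.symm
  refine ⟨s, fun a => ?_, ?_⟩
  · by_cases ha : ∃ j, j < 3 * N ∧ v (⟨0, hn⟩, j) = a
    · obtain ⟨j, hj, rfl⟩ := ha
      rw [← s1 j hj, ← s1 _ (succIdx_lt hj)]
      exact (hg j hj).1
    · have : s a = a := dif_neg ha
      simp only [this, true_or]
  · refine (h.sat_flatCore (A := B.expand s) (v := v) s1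
      fun x hx => hN ▸ h.lt_code_of_mem_vars hx).1 ?_
    exact (Fml.sat_reduct_expand _ B s v).2 hc

end Semantics

end Unary

/-! ### Flattening is primitive recursive on Gödel numbers -/

section Computability

theorem _root_.Nat.unpair_snd_lt {c : ℕ} (h : 0 < c.unpair.1) : c.unpair.2 < c := by
  have := Nat.add_le_pair c.unpair.1 c.unpair.2
  rw [Nat.pair_unpair] at this
  omega

/-- The code of the argument of a term with the given code. -/
def argCode (c : ℕ) : ℕ := (c.unpair.2.unpair.2 - 1).unpair.1

theorem argCode_lt {c : ℕ} (h : c.unpair.1 = 1) : argCode c < c :=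
  lt_of_le_of_lt ((Nat.unpair_left_le _).trans ((Nat.sub_le _ _).trans (Nat.unpair_right_le _)))
    (Nat.unpair_snd_lt (by omega))

/-- `Term.flat` on codes. -/
def flatTermCode (N c : ℕ) : ℕ :=
  if h : c.unpair.1 = 1 then
    have := argCode_lt h
    let d := flatTermCode N (argCode c)
    Nat.pair 0 (Nat.pair d.unpair.2.unpair.1 (succIdx N d.unpair.2.unpair.2))
  else c
termination_by c

theorem flatTermCode_of_argCode (N : ℕ) {c b d : ℕ} (h : c.unpair.1 = 1) (hb : argCode c = b)
    (hd : flatTermCode N b = d) : flatTermCode N c =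
      Nat.pair 0 (Nat.pair d.unpair.2.unpair.1 (succIdx N d.unpair.2.unpair.2)) := by
  subst hb hd
  rw [flatTermCode, dif_pos h]

/-- `Fml.flatCore` on codes. -/
def flatFmlCode (N c : ℕ) : ℕ :=
  if h : c.unpair.1 = 3 then
    have h1 : c.unpair.2.unpair.1 < c :=
      (Nat.unpair_left_le _).trans_lt (Nat.unpair_snd_lt (by omega))
    have h2 : c.unpair.2.unpair.2 < c :=
      (Nat.unpair_right_le _).trans_lt (Nat.unpair_snd_lt (by omega))
    Nat.pair 3 (Nat.pair (flatFmlCode N c.unpair.2.unpair.1) (flatFmlCode N c.unpair.2.unpair.2))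
  else if c.unpair.1 = 1 then
    Nat.pair 1 (Nat.pair (flatTermCode N c.unpair.2.unpair.1)
      (flatTermCode N c.unpair.2.unpair.2))
  else 0
termination_by c

variable {n : ℕ} {hn : 0 < n}

/-- Course-of-values recursion: both recursive values are looked up in the list of earlier values,
at positions below its length. Two calls suit implications; terms have one argument and use the same
call twice. -/
theorem Primrec.nat_strong_rec_two {c : ℕ → Prop} [DecidablePred c] {p q : ℕ → ℕ}
    {h : ℕ × ℕ × ℕ → ℕ} {b f : ℕ → ℕ → ℕ} (hc : PrimrecPred c) (hp : Primrec p) (hq : Primrec q)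
    (hh : Primrec h) (hb : Primrec₂ b) (hp' : ∀ m, c m → p m < m) (hq' : ∀ m, c m → q m < m)
    (hf : ∀ a m, f a m = if c m then h (a, f a (p m), f a (q m)) else b a m) :
    Primrec₂ f := by
  have hlen : Primrec fun x : ℕ × List ℕ => x.2.length := Primrec.list_length.comp Primrec.snd
  have hget : ∀ {r : ℕ → ℕ}, Primrec r →
      Primrec fun x : ℕ × List ℕ => x.2.getD (r x.2.length) 0 := fun hr =>
    (Primrec.list_getD 0).comp Primrec.snd (hr.comp hlen)
  refine Primrec.nat_strong_rec f (g := fun a l => some (if c l.length then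
    h (a, l.getD (p l.length) 0, l.getD (q l.length) 0) else b a l.length)) ?_ ?_
  · exact Primrec.option_some.comp (Primrec.ite (hc.comp hlen)
      (hh.comp (Primrec.fst.pair ((hget hp).pair (hget hq)))) (hb.comp Primrec.fst hlen))
  · intro a m
    simp only [List.length_map, List.length_range]
    rw [hf a m]
    split_ifs with hm
    · simp [hp' m hm, hq' m hm]
    · rfl

theorem primrec_succIdx : Primrec₂ succIdx :=
  Primrec.ite (Primrec.nat_lt.comp Primrec.snd
      (Primrec.nat_mul.comp (Primrec.const 2) Primrec.fst))
    (Primrec.nat_add.comp Primrec.snd Primrec.fst) (Primrec.nat_sub.comp Primrec.snd Primrec.fst)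

section Connectives

variable {L : Sig} {α : Type*} [Primcodable α] {f g : α → Fml L}

theorem Fml.primrec_imp (hf : Primrec fun a => (f a).code) (hg : Primrec fun a => (g a).code) :
    Primrec fun a => ((f a).imp (g a)).code :=
  Primrec₂.natPair.comp (Primrec.const 3) (Primrec₂.natPair.comp hf hg)

theorem Fml.primrec_neg (hf : Primrec fun a => (f a).code) : Primrec fun a => (f a).neg.code :=
  Fml.primrec_imp hf (Primrec.const _)

theorem Fml.primrec_or (hf : Primrec fun a => (f a).code) (hg : Primrec fun a => (g a).code) :
    Primrec fun a => ((f a).or (g a)).code :=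
  Fml.primrec_imp (Fml.primrec_neg hf) hg

theorem Fml.primrec_and (hf : Primrec fun a => (f a).code) (hg : Primrec fun a => (g a).code) :
    Primrec fun a => ((f a).and (g a)).code :=
  Fml.primrec_neg (Fml.primrec_imp hf (Fml.primrec_neg hg))

theorem Fml.primrec_eqVar (σ : L.Srt) {i j : α → ℕ} (hi : Primrec i) (hj : Primrec j) :
    Primrec fun a => (eqVar σ (i a) (j a)).code := by
  have key : ∀ {k : α → ℕ}, Primrec k →
      Primrec fun a => (Term.var σ (k a) : Term L σ).code := fun hk =>
    Primrec₂.natPair.comp (Primrec.const 0) (Primrec₂.natPair.comp (Primrec.const _) hk)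
  exact Primrec₂.natPair.comp (Primrec.const 1) (Primrec₂.natPair.comp (key hi) (key hj))

/-- The code of a conjunction in terms of the codes of its members. -/
def andCode (a b : ℕ) : ℕ :=
  Nat.pair 3 (Nat.pair (Nat.pair 3 (Nat.pair a (Nat.pair 3 (Nat.pair b (Nat.pair 0 0)))))
    (Nat.pair 0 0))

theorem Fml.code_and (φ ψ : Fml L) : (φ.and ψ).code = andCode φ.code ψ.code := rfl

theorem primrec_andCode : Primrec₂ andCode := by
  have c : ∀ k : ℕ, Primrec fun _ : ℕ × ℕ => k := fun k => Primrec.const k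
  have p := fun {f g : ℕ × ℕ → ℕ} (hf : Primrec f) (hg : Primrec g) => Primrec₂.natPair.comp hf hg
  exact p (c 3) (p (p (c 3) (p Primrec.fst (p (c 3) (p Primrec.snd (c _))))) (c _))

theorem Fml.primrec_allLt {k : α → ℕ} {f : α → ℕ → Fml L} (hk : Primrec k)
    (hf : Primrec₂ fun a i => (f a i).code) : Primrec fun a => (allLt (k a) (f a)).code := by
  refine (Primrec.nat_rec' hk (Primrec.const (verum : Fml L).code)
    (h := fun a p => andCode (f a p.1).code p.2) ?_).of_eq fun a => ?_
  · exact primrec_andCode.comp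
      (hf.comp Primrec.fst (Primrec.fst.comp Primrec.snd)) (Primrec.snd.comp Primrec.snd)
  · induction k a with
    | zero => rfl
    | succ k ih => rw [allLt, code_and, ← ih]

end Connectives

theorem primrec_graphFml : Primrec fun N => (graphFml hn N).code := by
  have h3 : Primrec fun N : ℕ => 3 * N := Primrec.nat_mul.comp (Primrec.const 3) Primrec.id
  have hs := primrec_succIdx.comp (Primrec.fst (α := ℕ) (β := ℕ)) Primrec.snd
  have hss := primrec_succIdx.comp (Primrec.fst (α := ℕ) (β := ℕ)) hs
  have hs1 := hs.comp (Primrec.fst (α := ℕ × ℕ) (β := ℕ))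
  have hs2 := primrec_succIdx.comp (Primrec.fst.comp (Primrec.fst (α := ℕ × ℕ) (β := ℕ)))
    Primrec.snd
  refine Fml.primrec_allLt h3 (Fml.primrec_and (Fml.primrec_or ?_ ?_)
    (Fml.primrec_allLt (h3.comp Primrec.fst) (Fml.primrec_imp ?_ ?_)))
  · exact Fml.primrec_eqVar _ hss Primrec.snd
  · exact Fml.primrec_eqVar _ hss hs
  · exact Fml.primrec_eqVar _ (Primrec.snd.comp Primrec.fst) Primrec.snd
  · exact Fml.primrec_eqVar _ hs1 hs2

theorem Term.code_flat (N : ℕ) {σ : (unarySig n hn).Srt} (t : Term (unarySig n hn) σ) :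
    (t.flat N).code = flatTermCode N t.code := by
  induction t with
  | var σ i =>
    rw [flatTermCode, dif_neg (by simp [Term.code])]
    rfl
  | app f a ih =>
    have h : (Term.app f a).code.unpair.1 = 1 := by simp [Term.code]
    have h' : argCode (Term.app f a).code = (a 0).code := by
      simp only [argCode, Term.code, Nat.unpair_pair]
      have : (List.ofFn fun k => (a k).code) = [(a 0).code] := rfl
      rw [this]
      simp
    rw [flatTermCode_of_argCode N h h' (ih 0).symm]
    simp only [Term.flat, Term.code, Nat.unpair_pair, Term.flatIdx]

theorem primrec_flatTermCode : Primrec₂ flatTermCode := by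
  have h1 := Primrec.fst.comp Primrec.unpair
  have h2 := Primrec.snd.comp Primrec.unpair
  have harg : Primrec argCode := h1.comp (Primrec.nat_sub.comp (h2.comp h2) (Primrec.const 1))
  have hd : Primrec fun x : ℕ × ℕ × ℕ => x.2.1.unpair.2 :=
    h2.comp (Primrec.fst.comp Primrec.snd)
  refine Primrec.nat_strong_rec_two (c := fun c => c.unpair.1 = 1) (p := argCode) (q := argCode)
    (h := fun x => Nat.pair 0 (Nat.pair x.2.1.unpair.2.unpair.1
      (succIdx x.1 x.2.1.unpair.2.unpair.2))) (b := fun _ c => c)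
    (Primrec.eq.comp h1 (Primrec.const 1)) harg harg ?_ Primrec.snd
    (fun _ => argCode_lt) (fun _ => argCode_lt) ?_
  · exact Primrec₂.natPair.comp (Primrec.const 0) (Primrec₂.natPair.comp (h1.comp hd)
      (primrec_succIdx.comp Primrec.fst (h2.comp hd)))
  · intro a m
    rw [flatTermCode]
    rfl

theorem Fml.code_flatCore (N : ℕ) {φ : Fml (unarySig n hn)} (h : φ.IsQF) :
    (φ.flatCore N).code = flatFmlCode N φ.code := by
  induction φ with
  | falsum =>
    rw [flatFmlCode, dif_neg (by simp [Fml.code]), if_neg (by simp [Fml.code])]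
    rfl
  | eq t u =>
    rw [flatFmlCode, dif_neg (by simp [Fml.code]), if_pos (by simp [Fml.code])]
    simp only [Fml.code, Nat.unpair_pair, ← Term.code_flat]
    rfl
  | rel P a => exact P.elim
  | imp φ ψ h1 h2 =>
    rw [flatFmlCode, dif_pos (by simp [Fml.code])]
    simp only [Fml.flatCore, Fml.code, Nat.unpair_pair, h1 h.1, h2 h.2]
  | all x φ _ => exact h.elim

theorem primrec_flatFmlCode : Primrec₂ flatFmlCode := by
  have h1 := Primrec.fst.comp Primrec.unpair
  have h2 := Primrec.snd.comp Primrec.unpair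
  have hr : ∀ m : ℕ, m.unpair.1 = 3 → m.unpair.2 < m := fun m hm =>
    Nat.unpair_snd_lt (by omega)
  refine Primrec.nat_strong_rec_two (c := fun c => c.unpair.1 = 3)
    (p := fun c => c.unpair.2.unpair.1) (q := fun c => c.unpair.2.unpair.2)
    (h := fun x => Nat.pair 3 (Nat.pair x.2.1 x.2.2))
    (b := fun N c => if c.unpair.1 = 1 then Nat.pair 1 (Nat.pair
      (flatTermCode N c.unpair.2.unpair.1) (flatTermCode N c.unpair.2.unpair.2)) else 0)
    (Primrec.eq.comp h1 (Primrec.const 3)) (h1.comp h2) (h2.comp h2) ?_ ?_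
    (fun m hm => (Nat.unpair_left_le _).trans_lt (hr m hm))
    (fun m hm => (Nat.unpair_right_le _).trans_lt (hr m hm)) ?_
  · exact Primrec₂.natPair.comp (Primrec.const 3) (Primrec₂.natPair.comp
      (Primrec.fst.comp Primrec.snd) (Primrec.snd.comp Primrec.snd))
  · exact Primrec.ite (Primrec.eq.comp (h1.comp Primrec.snd) (Primrec.const 1))
      (Primrec₂.natPair.comp (Primrec.const 1) (Primrec₂.natPair.comp
        (primrec_flatTermCode.comp Primrec.fst ((h1.comp h2).comp Primrec.snd))
        (primrec_flatTermCode.comp Primrec.fst ((h2.comp h2).comp Primrec.snd))))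
      (Primrec.const 0)
  · intro a m
    rw [flatFmlCode]
    rfl

theorem Fml.exists_primrec_code_flat (hn : 0 < n) :
    ∃ g : ℕ → ℕ, Primrec g ∧ ∀ φ : Fml (unarySig n hn), φ.IsQF → φ.flat.code = g φ.code := by
  refine ⟨fun c => andCode (flatFmlCode c c) (graphFml hn c).code, ?_, fun φ h => ?_⟩
  · exact primrec_andCode.comp (primrec_flatFmlCode.comp Primrec.id Primrec.id) primrec_graphFml
  · rw [Fml.flat, code_and, code_flatCore _ h]

/-- Both signatures encode sorts in the same way, so lifting acts as the identity on codes and costs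
nothing in computability. -/
theorem Fml.code_lift (φ : Fml (emptySig n)) : (Fml.lift hn φ).code = φ.code := by
  have key : ∀ {σ : Fin n} (t : Term (emptySig n) σ), (Term.lift hn t).code = t.code
    | _, .var _ _ => rfl
    | _, .app f _ => f.elim
  induction φ with
  | falsum => rfl
  | eq t u => simp only [Fml.lift, Fml.code, key]
  | rel P a => exact P.elim
  | imp φ ψ h1 h2 => simp only [Fml.lift, Fml.code, h1, h2]
  | all x φ h => simp only [Fml.lift, Fml.code, h]

end Computability

/-! ### Transfer of stable infinity and smoothness -/

section Transfer

variable {n : ℕ} {hn : 0 < n} {T : Theory (emptySig n)}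

theorem Theory.IsModel.expand {B : Struc.{u} (emptySig n)} (hB : T.IsModel B)
    {s : B.dom ⟨0, hn⟩ → B.dom ⟨0, hn⟩} (hs : ∀ a, s (s a) = a ∨ s (s a) = s a) :
    (T.addVee hn).IsModel (B.expand s) :=
  (T.isModel_addVee _).2
    ⟨fun φ hφ v => (Fml.sat_reduct_expand φ B s v).2 (hB φ hφ v), hs⟩

/-- Lifting of quantifier-free formulas. -/
def QF.lift (hn : 0 < n) (φ : QF (emptySig n)) : QF (unarySig n hn) :=
  ⟨Fml.lift hn φ.1, Fml.isQF_lift φ.2⟩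

/-- Flattening of quantifier-free formulas. -/
def QF.flat (φ : QF (unarySig n hn)) : QF (emptySig n) := ⟨φ.1.flat, φ.1.isQF_flat⟩

/-- The identity satisfies `s²(x) = x`, so it expands any model of `T`. -/
theorem Theory.exists_interp_lift (hn : 0 < n) {φ : Fml (emptySig n)} {I : Interp.{u} (emptySig n)}
    (hI : T.IsInterp I) (hs : I.Sat φ) :
    (T.addVee hn).IsInterp ⟨I.toStruc.expand (hn := hn) id, I.val⟩ ∧
      Interp.Sat ⟨I.toStruc.expand (hn := hn) id, I.val⟩ (Fml.lift hn φ) :=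
  ⟨Theory.IsModel.expand hI fun _ => Or.inl rfl,
    (Fml.sat_lift φ _ _).2 ((Fml.sat_reduct_expand φ _ _ _).2 hs)⟩

theorem Theory.stablyInfinite_addVee_iff (T : Theory (emptySig n)) :
    StablyInfinite.{u} (T.addVee hn) Set.univ ↔ StablyInfinite.{u} T Set.univ := by
  constructor
  · rintro H φ ⟨I, hI, hs⟩
    obtain ⟨J, hJ, hJs, hJi⟩ := H (φ.lift hn) ⟨_, exists_interp_lift hn hI hs⟩
    exact ⟨⟨J.toStruc.reduct, J.val⟩, ((T.isModel_addVee _).1 hJ).1,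
      (Fml.sat_lift φ.1 _ _).1 hJs, hJi⟩
  · rintro H φ ⟨I, hI, hs⟩
    obtain ⟨hT, hv⟩ := (T.isModel_addVee _).1 hI
    obtain ⟨w, -, hw⟩ := φ.2.exists_sat_flat hv hs
    obtain ⟨J, hJ, hJs, hJi⟩ := H φ.flat ⟨⟨I.toStruc.reduct, w⟩, hT, hw⟩
    obtain ⟨s, hs1, hs2⟩ := φ.2.exists_sat_of_sat_flat hJs
    exact ⟨⟨J.toStruc.expand s, J.val⟩, Theory.IsModel.expand hJ hs1, hs2, hJi⟩

theorem Theory.smooth_addVee_iff (T : Theory (emptySig n)) :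
    Smooth.{u} (T.addVee hn) Set.univ ↔ Smooth.{u} T Set.univ := by
  constructor
  · intro H φ I hI hs κ hκ
    obtain ⟨h1, h2⟩ := exists_interp_lift hn hI hs
    obtain ⟨J, hJ, hJs, hJi⟩ := H (φ.lift hn) _ h1 h2 κ hκ
    exact ⟨⟨J.toStruc.reduct, J.val⟩, ((T.isModel_addVee _).1 hJ).1,
      (Fml.sat_lift φ.1 _ _).1 hJs, hJi⟩
  · intro H φ I hI hs κ hκ
    obtain ⟨hT, hv⟩ := (T.isModel_addVee _).1 hI
    obtain ⟨w, -, hw⟩ := φ.2.exists_sat_flat hv hs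
    obtain ⟨J, hJ, hJs, hJi⟩ := H φ.flat ⟨I.toStruc.reduct, w⟩ hT hw κ hκ
    obtain ⟨s, hs1, hs2⟩ := φ.2.exists_sat_of_sat_flat hJs
    exact ⟨⟨J.toStruc.expand s, J.val⟩, Theory.IsModel.expand hJ hs1, hs2, hJi⟩

/-! ### Transfer of witnesses -/

theorem Theory.witnessEquiv_iff {L : Sig} (T : Theory L) (wit : QF L → QF L) :
    WitnessEquiv.{u} T wit ↔ ∀ (φ : QF L) (A : Struc.{u} L) (v : (x : L.Var) → A.dom x.1),
      T.IsModel A → (φ.1.Sat A v ↔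
        ∃ w, (∀ x ∈ φ.1.vars, w x = v x) ∧ (wit φ).1.Sat A w) := by
  constructor
  · intro H φ A v hA
    exact (H φ ⟨A, v⟩ hA).trans (Fml.sat_exs_vars_sdiff _ _ _)
  · intro H φ I hI
    exact (H φ I.toStruc I.val hI).trans (Fml.sat_exs_vars_sdiff _ _ _).symm

/-- The witness for the theory with `s` obtained from a witness for the theory without. -/
def QF.witAdd (wit : QF (emptySig n) → QF (emptySig n)) (φ : QF (unarySig n hn)) :
    QF (unarySig n hn) :=
  ⟨(Fml.lift hn (wit φ.flat).1).and φ.1,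
    (Fml.isQF_and _ _).2 ⟨Fml.isQF_lift (wit φ.flat).2, φ.2⟩⟩

/-- The conjunction of a witness with the formula, over the signature with `s`. -/
def QF.witLift (wit : QF (unarySig n hn) → QF (unarySig n hn)) (φ : QF (emptySig n)) :
    QF (unarySig n hn) :=
  ⟨(wit (φ.lift hn)).1.and (φ.lift hn).1, (Fml.isQF_and _ _).2 ⟨(wit (φ.lift hn)).2, (φ.lift hn).2⟩⟩

/-- The witness for the theory without `s` obtained from a witness for the theory with. -/
def QF.witRemove (wit : QF (unarySig n hn) → QF (unarySig n hn)) (φ : QF (emptySig n)) :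
    QF (emptySig n) :=
  (QF.witLift wit φ).flat

theorem QF.IsComputable.witAdd {wit : QF (emptySig n) → QF (emptySig n)}
    (h : QF.IsComputable wit) : QF.IsComputable (QF.witAdd (hn := hn) wit) := by
  obtain ⟨g, hg, hgw⟩ := h
  obtain ⟨k, hk, hkf⟩ := Fml.exists_primrec_code_flat hn
  refine ⟨fun c => andCode (g (k c)) c,
    primrec_andCode.to_comp.comp (hg.comp hk.to_comp) Computable.id, fun φ => ?_⟩
  rw [QF.witAdd, Fml.code_and, Fml.code_lift, ← hgw]
  change andCode (g (k φ.1.code)) φ.1.code = andCode (g φ.1.flat.code) φ.1.code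
  rw [hkf φ.1 φ.2]

theorem QF.IsComputable.witRemove {wit : QF (unarySig n hn) → QF (unarySig n hn)}
    (h : QF.IsComputable wit) : QF.IsComputable (QF.witRemove wit) := by
  obtain ⟨g, hg, hgw⟩ := h
  obtain ⟨k, hk, hkf⟩ := Fml.exists_primrec_code_flat hn
  refine ⟨fun c => k (andCode (g c) c),
    hk.to_comp.comp (primrec_andCode.to_comp.comp hg Computable.id), fun φ => ?_⟩
  have hl : (φ.lift hn).1.code = φ.1.code := Fml.code_lift φ.1
  change _ = (QF.witLift wit φ).1.flat.code
  rw [hkf _ (QF.witLift wit φ).2, QF.witLift, Fml.code_and, ← hgw, hl]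

/-- The conjunct `φ` makes the backward direction immediate. Forward, the values found for `φ.flat`
extend to its witness, and the variables of `φ` stay fixed because they occur in `φ.flat`. -/
theorem Theory.WitnessEquiv.witAdd {wit : QF (emptySig n) → QF (emptySig n)}
    (h : WitnessEquiv.{u} T wit) : WitnessEquiv.{u} (T.addVee hn) (QF.witAdd wit) := by
  rw [witnessEquiv_iff] at h ⊢
  intro φ A v hA
  obtain ⟨hT, hv⟩ := (T.isModel_addVee _).1 hA
  constructor
  · intro hs
    obtain ⟨w, hwv, hw⟩ := φ.2.exists_sat_flat hv hs
    obtain ⟨w', hw', hsat⟩ := (h φ.flat A.reduct w hT).1 hw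
    have e : ∀ x ∈ φ.1.vars, w' x = v x := fun x hx =>
      (hw' x (φ.2.vars_subset_flat hx)).trans (hwv x hx)
    exact ⟨w', e, (Fml.sat_and (A := A) _ _ w').2
      ⟨(Fml.sat_lift _ A w').2 hsat, (Fml.sat_congr φ.1 e).2 hs⟩⟩
  · rintro ⟨w, hw, hsat⟩
    exact (Fml.sat_congr φ.1 hw).1 ((Fml.sat_and _ _ w).1 hsat).2

/-- The conjunct `φ.lift` keeps the variables of `φ` among those of the flattened formula, so the
fresh variables cannot overwrite them even if the given witness omits some. Backward, it returns `φ`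
in the expansion supplied by flattening. -/
theorem Theory.WitnessEquiv.witRemove {wit : QF (unarySig n hn) → QF (unarySig n hn)}
    (h : WitnessEquiv.{u} (T.addVee hn) wit) : WitnessEquiv.{u} T (QF.witRemove wit) := by
  rw [witnessEquiv_iff] at h ⊢
  intro φ A v hA
  have hvars : ∀ x ∈ φ.1.vars, x ∈ (φ.lift hn).1.vars := fun x hx =>
    (Fml.vars_lift hn φ.1).symm ▸ hx
  constructor
  · intro hs
    obtain ⟨h1, h2⟩ := exists_interp_lift (I := ⟨A, v⟩) hn hA hs
    obtain ⟨w, hw, hsat⟩ := (h (φ.lift hn) (A.expand id) v h1).1 h2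
    obtain ⟨w', hw', hsat'⟩ := (QF.witLift wit φ).2.exists_sat_flat
      (A := A.expand id) (v := w) (fun _ => Or.inl rfl)
      ((Fml.sat_and _ _ w).2 ⟨hsat, (Fml.sat_congr _ hw).2 h2⟩)
    exact ⟨w', fun x hx => (hw' x (Fml.mem_vars_and.2 (Or.inr (hvars x hx)))).trans
      (hw x (hvars x hx)), (Fml.sat_reduct_expand _ A id w').1 hsat'⟩
  · rintro ⟨w, hw, hsat⟩
    obtain ⟨s, -, hs⟩ := (QF.witLift wit φ).2.exists_sat_of_sat_flat hsat
    have := (Fml.sat_lift φ.1 _ _).1 ((Fml.sat_and _ _ _).1 hs).2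
    exact (Fml.sat_congr φ.1 hw).1 ((Fml.sat_reduct_expand _ A s w).1 this)

/-- A quantifier-free formula over the empty signature only depends on which of its variables
have equal values. -/
theorem Fml.IsQF.sat_iff_of_eq_iff {φ : Fml (emptySig n)} (h : φ.IsQF)
    {A B : Struc.{u} (emptySig n)} {v : (x : (emptySig n).Var) → A.dom x.1}
    {w : (x : (emptySig n).Var) → B.dom x.1}
    (hvw : ∀ σ i j, (σ, i) ∈ φ.vars → (σ, j) ∈ φ.vars →
      (v (σ, i) = v (σ, j) ↔ w (σ, i) = w (σ, j))) : φ.Sat A v ↔ φ.Sat B w := by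
  induction φ with
  | falsum => rfl
  | @eq σ t u =>
    cases t with
    | app f a => exact f.elim
    | var _ i =>
      cases u with
      | app f a => exact f.elim
      | var _ j =>
        exact hvw σ i j (Fml.mem_vars_eq.2 (Or.inl (Term.mem_vars_var.2 rfl)))
          (Fml.mem_vars_eq.2 (Or.inr (Term.mem_vars_var.2 rfl)))
  | rel P a => exact P.elim
  | imp φ ψ h1 h2 =>
    exact imp_congr
      (h1 h.1 fun σ i j hi hj => hvw σ i j (Fml.mem_vars_imp.2 (Or.inl hi))
        (Fml.mem_vars_imp.2 (Or.inl hj)))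
      (h2 h.2 fun σ i j hi hj => hvw σ i j (Fml.mem_vars_imp.2 (Or.inr hi))
        (Fml.mem_vars_imp.2 (Or.inr hj)))
  | all y φ _ => exact h.elim

theorem Theory.IsWitness.witAdd {wit : QF (emptySig n) → QF (emptySig n)}
    (h : IsWitness.{u} T Set.univ wit) :
    IsWitness.{u} (T.addVee hn) Set.univ (QF.witAdd wit) := by
  refine ⟨h.1.witAdd, h.2.1.witAdd, ?_⟩
  rintro φ ⟨I, hI, hs⟩
  obtain ⟨B, hB, hBs, hBc⟩ := h.2.2 φ.flat ⟨⟨I.toStruc.reduct, I.val⟩,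
    ((T.isModel_addVee _).1 hI).1, (Fml.sat_lift _ _ _).1 ((Fml.sat_and _ _ _).1 hs).1⟩
  -- The witness implies the formula it witnesses under the same assignment, so `B` can be expanded
  -- without altering any value.
  have hBf : φ.1.flat.Sat B.toStruc B.val :=
    ((T.witnessEquiv_iff wit).1 h.2.1 φ.flat _ _ hB).2 ⟨B.val, fun _ _ => rfl, hBs⟩
  obtain ⟨s, hs1, hs2⟩ := φ.2.exists_sat_of_sat_flat hBf
  refine ⟨⟨B.toStruc.expand s, B.val⟩, Theory.IsModel.expand hB hs1,
    (Fml.sat_and _ _ _).2 ⟨(Fml.sat_lift _ _ _).2 ((Fml.sat_reduct_expand _ _ s _).2 hBs), hs2⟩,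
    fun σ hσ a => ?_⟩
  obtain ⟨i, hi, e⟩ := hBc σ hσ a
  exact ⟨i, Fml.mem_vars_and.2 (Or.inl ((Fml.vars_lift hn _).symm ▸ hi)), e⟩

theorem Theory.IsStrongWitness.witAdd {wit : QF (emptySig n) → QF (emptySig n)}
    (h : IsStrongWitness.{u} T Set.univ wit) :
    IsStrongWitness.{u} (T.addVee hn) Set.univ (QF.witAdd wit) := by
  refine ⟨h.1.witAdd, h.2.1.witAdd, ?_⟩
  rintro φ V E hV ⟨I, hI, hs⟩
  obtain ⟨hs, hd⟩ := (Fml.sat_and _ _ _).1 hs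
  obtain ⟨B, hB, hBs, hBc⟩ := h.2.2 φ.flat V E hV ⟨⟨I.toStruc.reduct, I.val⟩,
    ((T.isModel_addVee _).1 hI).1, (Fml.sat_and (A := I.toStruc.reduct) _ _ I.val).2
      ⟨(Fml.sat_lift _ _ _).1 ((Fml.sat_and _ _ _).1 hs).1,
        (Fml.sat_arrangement (A := I.toStruc.reduct) V E I.val).2
          ((Fml.sat_arrangement V E I.val).1 hd)⟩⟩
  obtain ⟨hBs, hBd⟩ := (Fml.sat_and _ _ _).1 hBs
  have hBf : φ.1.flat.Sat B.toStruc B.val :=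
    ((T.witnessEquiv_iff wit).1 h.2.1 φ.flat _ _ hB).2 ⟨B.val, fun _ _ => rfl, hBs⟩
  obtain ⟨s, hs1, hs2⟩ := φ.2.exists_sat_of_sat_flat hBf
  refine ⟨⟨B.toStruc.expand s, B.val⟩, Theory.IsModel.expand hB hs1,
    (Fml.sat_and (A := B.toStruc.expand s) _ _ B.val).2 ⟨(Fml.sat_and _ _ _).2
      ⟨(Fml.sat_lift _ _ _).2 ((Fml.sat_reduct_expand _ _ s _).2 hBs), hs2⟩,
        (Fml.sat_arrangement (A := B.toStruc.expand s) V E B.val).2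
          ((Fml.sat_arrangement (A := B.toStruc) V E B.val).1 hBd)⟩,
    fun σ hσ a => ?_⟩
  obtain ⟨i, hi, e⟩ := hBc σ hσ a
  refine ⟨i, Fml.mem_vars_and.2 ((Fml.mem_vars_and.1 hi).imp (fun hi =>
    Fml.mem_vars_and.2 (Or.inl ((Fml.vars_lift hn _).symm ▸ hi))) fun hi => ?_), e⟩
  rw [Fml.vars_arrangement] at hi ⊢
  exact hi

/-- Flattening changes only fresh variables. The variables that covered `J` keep their values and
still occur in the flattened formula, so the reduct remains covered. -/
theorem Theory.IsWitness.witRemove {wit : QF (unarySig n hn) → QF (unarySig n hn)}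
    (h : IsWitness.{u} (T.addVee hn) Set.univ wit) :
    IsWitness.{u} T Set.univ (QF.witRemove wit) := by
  refine ⟨h.1.witRemove, h.2.1.witRemove, ?_⟩
  rintro φ ⟨I, hI, hs⟩
  obtain ⟨s, hs1, hs2⟩ := (QF.witLift wit φ).2.exists_sat_of_sat_flat hs
  obtain ⟨J, hJ, hJs, hJc⟩ := h.2.2 (φ.lift hn) ⟨⟨I.toStruc.expand s, I.val⟩,
    Theory.IsModel.expand hI hs1, ((Fml.sat_and _ _ _).1 hs2).1⟩
  have hJf := (((T.addVee hn).witnessEquiv_iff wit).1 h.2.1 (φ.lift hn) _ _ hJ).2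
    ⟨J.val, fun _ _ => rfl, hJs⟩
  obtain ⟨hT, hv⟩ := (T.isModel_addVee _).1 hJ
  obtain ⟨w, hwv, hw⟩ := (QF.witLift wit φ).2.exists_sat_flat hv
    ((Fml.sat_and _ _ J.val).2 ⟨hJs, hJf⟩)
  refine ⟨⟨J.toStruc.reduct, w⟩, hT, hw, fun σ hσ a => ?_⟩
  obtain ⟨i, hi, e⟩ := hJc σ hσ a
  have hi' : (σ, i) ∈ (QF.witLift wit φ).1.vars := Fml.mem_vars_and.2 (Or.inl hi)
  exact ⟨i, (QF.witLift wit φ).2.vars_subset_flat hi', (hwv _ hi').trans e⟩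

/-- Reassigning fresh variables, as for plain witnesses, could break an arrangement that mentions
them. Instead the full equality pattern of `I` on the witness variables and `V` is imposed on the
covered model, and flattened formula and arrangement transfer by that pattern alone. -/
theorem Theory.IsStrongWitness.witRemove {wit : QF (unarySig n hn) → QF (unarySig n hn)}
    (h : IsStrongWitness.{u} (T.addVee hn) Set.univ wit) :
    IsStrongWitness.{u} T Set.univ (QF.witRemove wit) := by
  refine ⟨h.1.witRemove, h.2.1.witRemove, ?_⟩
  rintro φ V E - ⟨I, hI, hs⟩
  obtain ⟨hs, hd⟩ := (Fml.sat_and _ _ _).1 hs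
  obtain ⟨s, hs1, hs2⟩ := (QF.witLift wit φ).2.exists_sat_of_sat_flat hs
  classical
  let V' : Finset (unarySig n hn).Var := (QF.witRemove wit φ).1.vars ∪ V
  have hV' : ∀ x, x ∈ V' ↔ x ∈ (QF.witRemove wit φ).1.vars ∨ x ∈ V := fun x => Finset.mem_union
  -- The arrangement realized by `I` itself, hence satisfiable together with the given witness.
  let E' : (unarySig n hn).Srt → Setoid ℕ := fun σ => Setoid.ker fun i => I.val (σ, i)
  obtain ⟨J, hJ, hJs, hJc⟩ := h.2.2 (φ.lift hn) V' E' (fun _ _ => trivial)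
    ⟨⟨I.toStruc.expand s, I.val⟩, Theory.IsModel.expand hI hs1,
      (Fml.sat_and (A := I.toStruc.expand s) _ _ I.val).2 ⟨((Fml.sat_and _ _ _).1 hs2).1,
        (Fml.sat_arrangement (A := I.toStruc.expand s) V' E' I.val).2
          fun σ i j _ _ => Iff.rfl⟩⟩
  obtain ⟨-, hJd⟩ := (Fml.sat_and _ _ _).1 hJs
  rw [Fml.sat_arrangement] at hJd
  have key : ∀ χ : Fml (emptySig n), χ.IsQF → (∀ x ∈ χ.vars, x ∈ V') →
      χ.Sat I.toStruc I.val → χ.Sat J.toStruc.reduct J.val := fun χ hχ hsub =>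
    (hχ.sat_iff_of_eq_iff fun σ i j hi hj => (hJd σ i j (hsub _ hi) (hsub _ hj)).symm).1
  refine ⟨⟨J.toStruc.reduct, J.val⟩, ((T.isModel_addVee _).1 hJ).1,
    (Fml.sat_and (A := J.toStruc.reduct) _ _ J.val).2
      ⟨key _ (QF.witRemove wit φ).2 (fun x hx => (hV' x).2 (Or.inl hx)) hs,
        key _ (Fml.isQF_arrangement V E) (fun x hx => (hV' x).2 (Or.inr ?_)) hd⟩,
    fun σ hσ a => ?_⟩
  · rwa [Fml.vars_arrangement] at hx
  · obtain ⟨i, hi, e⟩ := hJc σ hσ a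
    refine ⟨i, Fml.mem_vars_and.2 ?_, e⟩
    rw [Fml.vars_arrangement]
    rcases Fml.mem_vars_and.1 hi with hi | hi
    · exact Or.inl ((QF.witLift wit φ).2.vars_subset_flat (Fml.mem_vars_and.2 (Or.inl hi)))
    · rw [Fml.vars_arrangement] at hi
      exact (hV' _).1 hi

/-! ### Failure of convexity -/

theorem Theory.not_convex_addVee {A : Struc.{u} (emptySig n)} (hA : T.IsModel A)
    (h2 : 2 ≤ Cardinal.mk (A.dom ⟨0, hn⟩)) : ¬ Convex.{u} (T.addVee hn) Set.univ := by
  intro H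
  obtain ⟨a, b, hab⟩ := Cardinal.two_le_iff.1 h2
  let σ : (unarySig n hn).Srt := ⟨0, hn⟩
  let x : ℕ → Term (unarySig n hn) σ := fun i => Term.var σ i
  have hΓ : ∀ (B : Struc.{u} (unarySig n hn)) (v : (x : (unarySig n hn).Var) → B.dom x.1),
      (Fml.bigAnd [Fml.eq (x 1) (sTerm hn (x 0)), Fml.eq (x 2) (sTerm hn (x 1))]).Sat B v ↔
        v (σ, 1) = B.succ (v (σ, 0)) ∧ v (σ, 2) = B.succ (v (σ, 1)) := by
    intro B v
    simp only [Fml.sat_bigAnd, List.mem_cons, List.not_mem_nil, or_false, forall_eq_or_imp,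
      forall_eq]
    rfl
  have hlit : ∀ l ∈ [Fml.eq (x 1) (sTerm hn (x 0)), Fml.eq (x 2) (sTerm hn (x 1))],
      l.IsLiteral := by
    intro l hl
    simp only [List.mem_cons, List.not_mem_nil, or_false] at hl
    rcases hl with rfl | rfl <;> exact Or.inl (Fml.IsAtomic.eq _ _)
  have hor : Theory.Valid.{u} (T.addVee hn) ((Fml.bigAnd [Fml.eq (x 1) (sTerm hn (x 0)),
      Fml.eq (x 2) (sTerm hn (x 1))]).imp (Fml.bigOr (([(σ, 2, 0), (σ, 2, 1)] :
        List ((unarySig n hn).Srt × ℕ × ℕ)).map fun p => Fml.eqVar p.1 p.2.1 p.2.2))) := by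
    intro I hI hs
    obtain ⟨h1, h2⟩ := (hΓ _ _).1 hs
    obtain ⟨-, hv⟩ := (T.isModel_addVee _).1 hI
    simp only [List.map, Fml.bigOr, Fml.sat_or, Fml.sat_eqVar]
    rcases hv (I.val (σ, 0)) with e | e
    · exact Or.inl (by rw [h2, h1, e])
    · exact Or.inr (Or.inl (by rw [h2, h1, e]))
  obtain ⟨p, hp, hval⟩ := H _ _ hlit (List.cons_ne_nil _ _) (fun _ _ => trivial) hor
  classical
  -- Only values of sort `σ₁` matter; other sorts get arbitrary elements.
  have val : ∀ c : ℕ → A.dom ⟨0, hn⟩, ∃ v : (x : (unarySig n hn).Var) → A.dom x.1,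
      ∀ i, v (σ, i) = c i := fun c =>
    ⟨fun x => if hx : x.1 = ⟨0, hn⟩ then hx ▸ c x.2 else (A.nonempty x.1).some,
      fun i => dif_pos rfl⟩
  simp only [List.mem_cons, List.not_mem_nil, or_false] at hp
  rcases hp with rfl | rfl
  -- Against `x₂ = x₀`: `s` is constantly `a`, with `x₀ = b` and `x₁ = x₂ = a`.
  · obtain ⟨v, hv⟩ := val fun i => if i = 0 then b else a
    have := hval ⟨A.expand fun _ => a, v⟩ (hA.expand (s := fun _ => a) fun _ => Or.inr rfl)
      ((hΓ (A.expand fun _ => a) v).2 ⟨hv 1, hv 2⟩)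
    exact hab ((hv 2).symm.trans (this.trans (hv 0)))
  -- Against `x₂ = x₁`: `s` swaps `a` and `b`, with `x₀ = x₂ = a` and `x₁ = b`.
  · obtain ⟨v, hv⟩ := val fun i => if i = 1 then b else a
    have := hval ⟨A.expand (Equiv.swap a b), v⟩
      (hA.expand fun c => Or.inl (Equiv.swap_apply_self a b c))
      ((hΓ (A.expand (Equiv.swap a b)) v).2 ⟨?_, ?_⟩)
    · exact hab ((hv 2).symm.trans (this.trans (hv 1)))
    · exact (hv 1).trans ((Equiv.swap_apply_left a b).symm.trans
        (congrArg (Equiv.swap a b) (hv 0).symm))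
    · exact (hv 2).trans ((Equiv.swap_apply_right a b).symm.trans
        (congrArg (Equiv.swap a b) (hv 1).symm))

end Transfer

end ManySorted

universe u in
theorem mainTheorem11 (n : ℕ) (hn : 0 < n) (T : ManySorted.Theory (ManySorted.emptySig n)) :
    (ManySorted.Theory.StablyInfinite.{u} (T.addVee hn) Set.univ ↔
        ManySorted.Theory.StablyInfinite.{u} T Set.univ) ∧
    (ManySorted.Theory.Smooth.{u} (T.addVee hn) Set.univ ↔
        ManySorted.Theory.Smooth.{u} T Set.univ) ∧
    (ManySorted.Theory.FinitelyWitnessable.{u} (T.addVee hn) Set.univ ↔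
        ManySorted.Theory.FinitelyWitnessable.{u} T Set.univ) ∧
    (ManySorted.Theory.StronglyFinitelyWitnessable.{u} (T.addVee hn) Set.univ ↔
        ManySorted.Theory.StronglyFinitelyWitnessable.{u} T Set.univ) ∧
    ((∃ A : ManySorted.Struc.{u} (ManySorted.emptySig n),
        T.IsModel A ∧ 2 ≤ Cardinal.mk (A.dom ⟨0, hn⟩)) →
      ¬ ManySorted.Theory.Convex.{u} (T.addVee hn) Set.univ) :=
  ⟨T.stablyInfinite_addVee_iff, T.smooth_addVee_iff,
    ⟨fun ⟨_, h⟩ => ⟨_, h.witRemove⟩, fun ⟨_, h⟩ => ⟨_, h.witAdd⟩⟩,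
    ⟨fun ⟨_, h⟩ => ⟨_, h.witRemove⟩, fun ⟨_, h⟩ => ⟨_, h.witAdd⟩⟩,
    fun ⟨_, hA, h2⟩ => ManySorted.Theory.not_convex_addVee hA h2⟩
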